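/- **Setting.** Let $T_\Sigma$ be the set of closed terms (moves) built from a constant $e$, unary symbols $l,r$ and a binary symbol $\langle\ ,\ \rangle$. Let $\mathcal P$ be the set of partial involutions on $T_\Sigma$, i.e. partial injective functions $f:T_\Sigma\rightharpoonup T_\Sigma$ with $f(u)=v\Leftrightarrow f(v)=u$, identified with their graphs. For $i,j\in\{l,r\}$ put $f_{ij}=\{(u,v)\mid (i(u),j(v))\in f\}$, and define application by $f\cdot g=f_{rr}\cup(f_{rl};g;(f_{ll};g)^*;f_{lr})$, where $;$ is composition in diagrammatic order. Let $B,C,I,K\in\mathcal P$ consist of the following pairs (in both directions, for all $x\in T_\Sigma$): $B: r^3x\leftrightarrow lrx,\ l^2x\leftrightarrow rlrx,\ rl^2x\leftrightarrow r^2lx$; $C: l^2x\leftrightarrow r^2lx,\ lrlx\leftrightarrow rlx,\ lr^2x\leftrightarrow r^3x$; $I: lx\leftrightarrow rx$; $K: lx\leftrightarrow r^2x$. A *strictly linear combinatory algebra* is a set $A$ with a binary application (written by juxtaposition, associating to the left) and elements $B,C,I$ such that $Bxyz=x(yz)$, $Cxyz=(xz)y$, $Ix=x$ for all $x,y,z\in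 A$; a *strictly affine combinatory algebra* has in addition an element $K$ with $Kxy=x$. The *strictly linear* (resp. *affine*) $\lambda$-calculus has as terms those $\lambda$-terms with constants in which every abstraction $\lambda x.M$ binds exactly one (resp. at most one) free occurrence of $x$ in $M$; its provable equality is the congruence generated by $\beta$ and $\xi$ restricted to such terms. A combinatory term over $A$ is built by application from variables, constants $c_a$ ($a\in A$), and the combinator symbols $B,C,I$ (and $K$ in the affine case). Its translation $(M)_\lambda$ replaces $B,C,I,K$ by $\lambda xyz.x(yz)$, $\lambda xyz.(xz)y$, $\lambda x.x$, $\lambda xy.x$, and leaves variables and the constants $c_a$ unchanged; a closed $M$ has its evident value $[\![M]\!]\in A$, with $[\![c_a]\!]=a$. The algebra is a *strictly linear (affine) $\lambda$-algebra* if, for all closed combinatory terms $M,N$ over $A$, provable equality of $(M)_\lambda$ and $(N)_\lambda$ in the strictly linear (affine) $\lambda$-calculus implies $[\![M]\!]=[\![N]\!]$. It is a *strictly linear (affine) combinatory $\lambda$-model* if it has a *selector*: an element $\epsilon\in A$ such that for all $x,y\in A$, $\epsilon xy=xy$, and $(\forall z\in A.\ xz=yz)$ implies $\epsilon x=\epsilon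 y$. **Theorem.** (i) $(\mathcal P,\cdot)$ with $B,C,I$ is a strictly linear combinatory algebra and a strictly linear $\lambda$-algebra. No $\epsilon\in\mathcal P$ is a selector, so it is not a strictly linear combinatory $\lambda$-model. (ii) $(\mathcal P,\cdot)$ with $B,C,I,K$ is a strictly affine combinatory algebra but not a strictly affine $\lambda$-algebra: $(BBK)_\lambda$ and $(BKK)_\lambda$ are provably equal in the strictly affine $\lambda$-calculus, but $[\![BBK]\!]\neq[\![BKK]\!]$ in $\mathcal P$. -/

import Mathlib

namespace StrictLambda

/-! ### Combinatory logic and lambda calculus, strictly linear and strictly affine -/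

/-- The two fragments. -/
inductive Frag where
  | linear
  | affine

/-- The distinguished combinators of a fragment: `B, C, I`, and also `K` in the affine case. -/
inductive Comb : Frag → Type where
  | B {X : Frag} : Comb X
  | C {X : Frag} : Comb X
  | I {X : Frag} : Comb X
  | K : Comb Frag.affine

universe u

/-- Terms of combinatory logic over the combinators of the fragment `X`, with variables `x₀, x₁, …`
and a constant `c_a` for each `a : A`. -/
inductive CLTerm (X : Frag) (A : Type u) : Type u where
  | var (n : ℕ) : CLTerm X A
  | comb (k : Comb X) : CLTerm X A
  | const (a : A) : CLTerm X A
  | app (M N : CLTerm X A) : CLTerm X A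

/-- Raw lambda terms in de Bruijn notation, with constants in `A`. -/
inductive LTerm (A : Type u) : Type u where
  | var (n : ℕ) : LTerm A
  | const (a : A) : LTerm A
  | app (M N : LTerm A) : LTerm A
  | lam (M : LTerm A) : LTerm A

namespace LTerm

variable {A : Type u}

/-- The number of free occurrences of the variable with index `k`. -/
def occ : ℕ → LTerm A → ℕ
  | k, var n => if n = k then 1 else 0
  | _, const _ => 0
  | k, app M N => occ k M + occ k N
  | k, lam M => occ (k + 1) M

/-- Renaming of free variables. -/
def rename : (ℕ → ℕ) → LTerm A → LTerm A
  | f, var n => var (f n)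
  | _, const a => const a
  | f, app M N => app (rename f M) (rename f N)
  | f, lam M => lam (rename (fun n => Nat.casesOn n 0 (fun m => f m + 1)) M)

/-- The substitution `σ` moved under one binder. -/
def up (σ : ℕ → LTerm A) : ℕ → LTerm A
  | 0 => var 0
  | n + 1 => rename Nat.succ (σ n)

/-- Simultaneous capture-avoiding substitution. -/
def subst : (ℕ → LTerm A) → LTerm A → LTerm A
  | σ, var n => σ n
  | _, const a => const a
  | σ, app M N => app (subst σ M) (subst σ N)
  | σ, lam M => lam (subst (up σ) M)

/-- `M[N/x]`, where `x` is the variable with index `0` of the body `M` of an abstraction. -/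
def inst (M N : LTerm A) : LTerm A :=
  subst (fun n => Nat.casesOn n N var) M

/-- The side condition for abstracting the variable with index `0`: it occurs free exactly once
(linear), respectively at most once (affine). -/
def Abstractable : Frag → LTerm A → Prop
  | Frag.linear, M => occ 0 M = 1
  | Frag.affine, M => occ 0 M ≤ 1

/-- Membership in the language of the strictly linear (affine) lambda calculus. -/
def WF (X : Frag) : LTerm A → Prop
  | var _ => True
  | const _ => True
  | app M N => WF X M ∧ WF X N
  | lam M => WF X M ∧ Abstractable X M

/-- Provable equality of the strictly linear (affine) lambda calculus. -/
inductive Eqv (X : Frag) : LTerm A → LTerm A → Prop where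
  | beta {M N : LTerm A} : WF X (lam M) → WF X N → Eqv X (app (lam M) N) (inst M N)
  | xi {M N : LTerm A} : Eqv X M N → Abstractable X M → Abstractable X N →
      Eqv X (lam M) (lam N)
  | app {M M' N N' : LTerm A} : Eqv X M M' → Eqv X N N' → Eqv X (app M N) (app M' N')
  | refl {M : LTerm A} : WF X M → Eqv X M M
  | symm {M N : LTerm A} : Eqv X M N → Eqv X N M
  | trans {M N P : LTerm A} : Eqv X M N → Eqv X N P → Eqv X M P

end LTerm

/-- The lambda term of a combinator:
`B = λxyz.x(yz)`, `C = λxyz.(xz)y`, `I = λx.x`, `K = λxy.x`. -/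
def Comb.toLam {X : Frag} {A : Type u} : Comb X → LTerm A
  | .B => .lam (.lam (.lam (.app (.var 2) (.app (.var 1) (.var 0)))))
  | .C => .lam (.lam (.lam (.app (.app (.var 2) (.var 0)) (.var 1))))
  | .I => .lam (.var 0)
  | .K => .lam (.lam (.var 1))

namespace CLTerm

variable {X : Frag} {A : Type u}

/-- The translation into lambda terms: each combinator is replaced by its lambda term. -/
def toLam : CLTerm X A → LTerm A
  | var n => .var n
  | comb k => k.toLam
  | const a => .const a
  | app M N => .app (toLam M) (toLam N)

/-- No variable occurs. -/
def IsClosed : CLTerm X A → Prop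
  | var _ => False
  | comb _ => True
  | const _ => True
  | app M N => IsClosed M ∧ IsClosed N

end CLTerm

/-! ### Combinatory algebras, lambda algebras, combinatory models -/

/-- An applicative structure with distinguished elements for the combinators of `X`;
the laws are in `IsCombAlgebra`. -/
structure CombStructure (X : Frag) (A : Type u) where
  app : A → A → A
  comb : Comb X → A

namespace CombStructure

variable {X : Frag} {A : Type u}

/-- The equations of the combinators `B`, `C`, `I`. -/
structure SatisfiesBCI (𝒜 : CombStructure X A) : Prop where
  B_law : ∀ x y z : A,
    𝒜.app (𝒜.app (𝒜.app (𝒜.comb .B) x) y) z = 𝒜.app x (𝒜.app y z)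
  C_law : ∀ x y z : A,
    𝒜.app (𝒜.app (𝒜.app (𝒜.comb .C) x) y) z = 𝒜.app (𝒜.app x z) y
  I_law : ∀ x : A, 𝒜.app (𝒜.comb .I) x = x

/-- Strictly linear (affine) combinatory algebras. -/
def IsCombAlgebra : {X : Frag} → CombStructure X A → Prop
  | .linear, 𝒜 => 𝒜.SatisfiesBCI
  | .affine, 𝒜 => 𝒜.SatisfiesBCI ∧ ∀ x y : A, 𝒜.app (𝒜.app (𝒜.comb .K) x) y = x

/-- The interpretation of a term under a valuation of its variables; for a closed term it does not
depend on the valuation. -/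
def interp (𝒜 : CombStructure X A) (ρ : ℕ → A) : CLTerm X A → A
  | .var n => ρ n
  | .comb k => 𝒜.comb k
  | .const a => a
  | .app M N => 𝒜.app (interp 𝒜 ρ M) (interp 𝒜 ρ N)

/-- Strictly linear (affine) lambda algebras: closed terms, with constants from `A`, whose
translations are provably equal have equal interpretations. -/
def IsLambdaAlgebra (𝒜 : CombStructure X A) : Prop :=
  𝒜.IsCombAlgebra ∧
    ∀ M N : CLTerm X A, M.IsClosed → N.IsClosed →
      LTerm.Eqv X M.toLam N.toLam → ∀ ρ : ℕ → A, 𝒜.interp ρ M = 𝒜.interp ρ N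

/-- `ε` is a selector: `εxy = xy`, and `εx = εy` whenever `x` and `y` have the same applicative
behaviour. -/
def IsSelector (𝒜 : CombStructure X A) (ε : A) : Prop :=
  (∀ x y : A, 𝒜.app (𝒜.app ε x) y = 𝒜.app x y) ∧
    ∀ x y : A, (∀ z : A, 𝒜.app x z = 𝒜.app y z) → 𝒜.app ε x = 𝒜.app ε y

/-- Strictly linear (affine) combinatory lambda models. -/
def IsCombinatoryModel (𝒜 : CombStructure X A) : Prop :=
  𝒜.IsCombAlgebra ∧ ∃ ε : A, 𝒜.IsSelector ε

end CombStructure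

/-! ### Partial involutions -/

/-- The language of moves: one constant, two unary symbols, one binary symbol. -/
inductive Move where
  | e : Move
  | l (t : Move) : Move
  | r (t : Move) : Move
  | pair (s t : Move) : Move

/-- Partial involutions on moves, given by their graphs: partial functions `f` with
`f(u) = v ↔ f(v) = u`. Injectivity follows from the two fields. -/
@[ext]
structure PInv where
  rel : Move → Move → Prop
  symm : ∀ {u v : Move}, rel u v → rel v u
  functional : ∀ {u v w : Move}, rel u v → rel u w → v = w

namespace PInv

/-- `f_{ij} = {(u, v) | (i(u), j(v)) ∈ f}`. -/
def part (f : PInv) (i j : Move → Move) (u v : Move) : Prop := f.rel (i u) (j v)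

open Relation in
/-- The graph of the linear application
`f · g = f_rr ∪ (f_rl ; g ; (f_ll ; g)^* ; f_lr)`, where `;` is composition in diagram order. -/
def appRel (f g : PInv) (u v : Move) : Prop :=
  f.part .r .r u v ∨
    Comp (Comp (Comp (f.part .r .l) g.rel) (ReflTransGen (Comp (f.part .l .l) g.rel)))
      (f.part .l .r) u v

theorem loop_symm (f g : PInv) {a b d : Move} (hab : g.rel a b)
    (h : Relation.ReflTransGen (Relation.Comp (f.part .l .l) g.rel) b d) :
    ∃ c, g.rel d c ∧ Relation.ReflTransGen (Relation.Comp (f.part .l .l) g.rel) c a := by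
  induction h with
  | refl => exact ⟨a, g.symm hab, .refl⟩
  | tail _ h2 ih =>
    obtain ⟨c, hc, hca⟩ := ih
    obtain ⟨x, hx, hxd⟩ := h2
    exact ⟨x, g.symm hxd, .head ⟨_, f.symm hx, hc⟩ hca⟩

theorem appRel_symm (f g : PInv) {u v : Move} (h : appRel f g u v) : appRel f g v u := by
  rcases h with h | ⟨d, ⟨b, ⟨a, h1, h2⟩, h3⟩, h4⟩
  · exact Or.inl (f.symm h)
  · obtain ⟨c, hc, hca⟩ := loop_symm f g h2 h3
    exact Or.inr ⟨a, ⟨c, ⟨d, f.symm h4, hc⟩, hca⟩, f.symm h1⟩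

theorem loop_functional (f g : PInv) {b d d' v w : Move}
    (h : Relation.ReflTransGen (Relation.Comp (f.part .l .l) g.rel) b d)
    (h' : Relation.ReflTransGen (Relation.Comp (f.part .l .l) g.rel) b d')
    (hv : f.part .l .r d v) (hw : f.part .l .r d' w) : v = w := by
  induction h using Relation.ReflTransGen.head_induction_on with
  | refl =>
    rcases Relation.ReflTransGen.cases_head h' with rfl | ⟨c, ⟨x, hx, _⟩, _⟩
    · exact Move.r.inj (f.functional hv hw)
    · cases f.functional hv hx
  | head h1 _ ih =>
    obtain ⟨x, hx, hxc⟩ := h1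
    rcases Relation.ReflTransGen.cases_head h' with rfl | ⟨c, ⟨y, hy, hyc⟩, h2⟩
    · cases f.functional hx hw
    · cases Move.l.inj (f.functional hx hy)
      cases g.functional hxc hyc
      exact ih h2

theorem appRel_functional (f g : PInv) {u v w : Move}
    (h : appRel f g u v) (h' : appRel f g u w) : v = w := by
  rcases h with h | ⟨d, ⟨b, ⟨a, h1, h2⟩, h3⟩, h4⟩ <;>
    rcases h' with h' | ⟨d', ⟨b', ⟨a', h1', h2'⟩, h3'⟩, h4'⟩
  · exact Move.r.inj (f.functional h h')
  · cases f.functional h h1'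
  · cases f.functional h1 h'
  · cases Move.l.inj (f.functional h1 h1')
    cases g.functional h2 h2'
    exact loop_functional f g h3 h3' h4 h4'

/-- Linear application of partial involutions. -/
def app (f g : PInv) : PInv where
  rel := appRel f g
  symm := appRel_symm f g
  functional := appRel_functional f g

open Move

/-- The pairs `u ↔ v` of a combinator, each listed in one direction:
* `B : r³x ↔ lrx, l²x ↔ rlrx, rl²x ↔ r²lx`
* `C : l²x ↔ r²lx, lrlx ↔ rlx, lr²x ↔ r³x`
* `I : lx ↔ rx`
* `K : lx ↔ r²x` -/
def pairs {X : Frag} : Comb X → Move → Move → Prop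
  | .B, u, v => ∃ x, (u = r (r (r x)) ∧ v = l (r x)) ∨ (u = l (l x) ∧ v = r (l (r x))) ∨
      (u = r (l (l x)) ∧ v = r (r (l x)))
  | .C, u, v => ∃ x, (u = l (l x) ∧ v = r (r (l x))) ∨ (u = l (r (l x)) ∧ v = r (l x)) ∨
      (u = l (r (r x)) ∧ v = r (r (r x)))
  | .I, u, v => ∃ x, u = l x ∧ v = r x
  | .K, u, v => ∃ x, u = l x ∧ v = r (r x)

theorem pairs_functional {X : Frag} (k : Comb X) {u v w : Move}
    (h : pairs k u v ∨ pairs k v u) (h' : pairs k u w ∨ pairs k w u) : v = w := by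
  cases k <;> simp only [pairs] at h h' <;> grind (splits := 20)

/-- The partial involution of a combinator. -/
def comb {X : Frag} (k : Comb X) : PInv where
  rel u v := pairs k u v ∨ pairs k v u
  symm := Or.symm
  functional := pairs_functional k

/-- The strictly linear (affine) structure of partial involutions. -/
def structureP (X : Frag) : CombStructure X PInv where
  app := app
  comb := comb

end PInv

/-- The term `BBK`. -/
def BBK (A : Type u) : CLTerm Frag.affine A :=
  .app (.app (.comb .B) (.comb .B)) (.comb .K)

/-- The term `BKK`. -/
def BKK (A : Type u) : CLTerm Frag.affine A :=
  .app (.app (.comb .B) (.comb .K)) (.comb .K)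

end StrictLambda

/-! The linear part is a soundness argument for an interpretation by execution paths. A λ-term
denotes a relation between points, which are moves at its output or at the port of a free variable.
A variable is a wire, application runs alternating paths between function and argument, and
abstraction only readdresses a port as the `l` half of the output. Without ports this application is
that of partial involutions (`app_const`), and the λ-terms of `B`, `C`, `I` denote the given
involutions (`den_toLam_comb`). It remains to validate β (`den_beta`). Applying an abstraction plugs
the argument into the bound port (`rename_some_app_curry`); plugging travels through the term
(`cut_curry`, `cut_app_left`, `cut_app_right`) down to the unique occurrence of the variable, where
it meets a wire (`cut_wire`). The combinatory laws are then instances of provable equalities.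

A selector would have to reproduce the behaviour of arbitrary elements. Testing it on one-pair
involutions forces it to transmit argument moves, including those of an involution with only
`l`-to-`l` pairs. Such an involution behaves like the empty one, yet its image differs.

In the affine case an erased argument may still contain paths between its own ports, and execution
keeps them. Closed arguments have no ports, so the law of `K` survives, but ξ lets an open term `y
z` be erased, which separates `BBK` from `BKK`. -/

namespace StrictLambda

/-! ### Alternating paths -/

/-- Alternating paths `E ; (c ; E)^*`. -/
inductive Path {S : Type} (E c : S → S → Prop) : S → S → Prop where
  | single {s t : S} : E s t → Path E c s t
  | cons {s a b t : S} : E s a → c a b → Path E c b t → Path E c s t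

namespace Path

variable {S T : Type} {E c : S → S → Prop}

theorem append {s a b t : S} (h : Path E c s a) (hc : c a b) (h' : Path E c b t) :
    Path E c s t := by
  induction h with
  | single h => exact .cons h hc h'
  | cons h1 h2 _ ih => exact .cons h1 h2 (ih hc)

theorem mono {c' : S → S → Prop} (hc : ∀ s t, c s t → c' s t) {s t : S} (h : Path E c s t) :
    Path E c' s t := by
  induction h with
  | single h => exact .single h
  | cons h1 h2 _ ih => exact .cons h1 (hc _ _ h2) ih

theorem exists_head {s t : S} (h : Path E c s t) : ∃ a, E s a := by
  cases h with
  | single h => exact ⟨_, h⟩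
  | cons h _ _ => exact ⟨_, h⟩

theorem exists_last {s t : S} (h : Path E c s t) : ∃ a, E a t := by
  induction h with
  | single h => exact ⟨_, h⟩
  | cons _ _ _ ih => exact ih

/-- Paths starting in a closed part of the state space. -/
theorem embed {E' c' : T → T → Prop} {i : T → S}
    (hE : ∀ s u, E (i s) u ↔ ∃ t, u = i t ∧ E' s t)
    (hc : ∀ s u, c (i s) u ↔ ∃ t, u = i t ∧ c' s t) {s : T} {u : S} :
    Path E c (i s) u ↔ ∃ t, u = i t ∧ Path E' c' s t := by
  constructor
  · intro h
    generalize hs : i s = s' at h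
    induction h generalizing s with
    | single h =>
      subst hs
      obtain ⟨t, rfl, h'⟩ := (hE _ _).1 h
      exact ⟨t, rfl, .single h'⟩
    | cons h1 h2 _ ih =>
      subst hs
      obtain ⟨a, rfl, h1'⟩ := (hE _ _).1 h1
      obtain ⟨b, rfl, h2'⟩ := (hc _ _).1 h2
      obtain ⟨t, rfl, h⟩ := ih rfl
      exact ⟨t, rfl, .cons h1' h2' h⟩
  · rintro ⟨t, rfl, h⟩
    induction h with
    | single h => exact .single ((hE _ _).2 ⟨_, rfl, h⟩)
    | cons h1 h2 _ ih => exact .cons ((hE _ _).2 ⟨_, rfl, h1⟩) ((hc _ _).2 ⟨_, rfl, h2⟩) ih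

/-- Paths starting in a closed part of the state space that meets no link. -/
theorem embed_of_no_link {E' : T → T → Prop} {i : T → S}
    (hE : ∀ s u, E (i s) u ↔ ∃ t, u = i t ∧ E' s t)
    (hc : ∀ s u, ¬ c (i s) u) {s : T} {u : S} :
    Path E c (i s) u ↔ ∃ t, u = i t ∧ E' s t := by
  rw [embed (E' := E') (c' := fun _ _ => False) hE (by simpa using hc)]
  constructor
  · rintro ⟨t, rfl, h | ⟨_, h, _⟩⟩
    · exact ⟨t, rfl, h⟩
    · exact h.elim
  · rintro ⟨t, rfl, h⟩
    exact ⟨t, rfl, .single h⟩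

/-- Paths over a relation that consists itself of paths are paths along both kinds of links. -/
theorem nest {c₁ c₂ : S → S → Prop} {H d : T → T → Prop} {J : T → S → Prop}
    (hH : ∀ x y, H x y ↔ ∃ s t, J x s ∧ J y t ∧ Path E c₁ s t)
    (h₁ : ∀ x y s t, d x y → J x s → J y t → (∃ a, E a s) → (∃ a, E t a) → c₂ s t)
    (h₂ : ∀ s t, c₂ s t → ∃ x y, d x y ∧ J x s ∧ J y t) {x y : T} :
    Path H d x y ↔ ∃ s t, J x s ∧ J y t ∧ Path E (fun a b => c₁ a b ∨ c₂ a b) s t := by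
  constructor
  · intro h
    induction h with
    | single h =>
      obtain ⟨s, t, hs, ht, h⟩ := (hH _ _).1 h
      exact ⟨s, t, hs, ht, h.mono fun _ _ => Or.inl⟩
    | cons h hd _ ih =>
      obtain ⟨s, t, hs, ht, h⟩ := (hH _ _).1 h
      obtain ⟨s', t', hs', ht', h'⟩ := ih
      exact ⟨s, t', hs, ht', (h.mono fun _ _ => Or.inl).append
        (Or.inr (h₁ _ _ _ _ hd ht hs' h.exists_last h'.exists_head)) h'⟩
  · rintro ⟨s, t, hs, ht, h⟩
    -- Cut the path at its first `c₂` link: either there is none, or the part after it is already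
    -- regrouped as a path over `H`.
    have key : Path E c₁ s t ∨ ∃ s₁ s₂ x₁ x₂, Path E c₁ s s₁ ∧ J x₁ s₁ ∧ J x₂ s₂ ∧ d x₁ x₂ ∧
        Path H d x₂ y := by
      clear hs
      induction h with
      | single h => exact Or.inl (.single h)
      | cons h hc _ ih =>
        rcases hc with hc | hc
        · rcases ih ht with h' | ⟨s₁, s₂, x₁, x₂, h', hJ⟩
          · exact Or.inl (.cons h hc h')
          · exact Or.inr ⟨s₁, s₂, x₁, x₂, .cons h hc h', hJ⟩
        · obtain ⟨x₁, x₂, hd, hx₁, hx₂⟩ := h₂ _ _ hc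
          refine Or.inr ⟨_, _, x₁, x₂, .single h, hx₁, hx₂, hd, ?_⟩
          rcases ih ht with h' | ⟨s₁, s₂, y₁, y₂, h', hy₁, hy₂, hd', hp⟩
          · exact .single ((hH _ _).2 ⟨_, _, hx₂, ht, h'⟩)
          · exact .cons ((hH _ _).2 ⟨_, _, hx₂, hy₁, h'⟩) hd' hp
    rcases key with h | ⟨s₁, s₂, x₁, x₂, h, hx₁, _, hd, hp⟩
    · exact .single ((hH _ _).2 ⟨_, _, hs, ht, h⟩)
    · exact .cons ((hH _ _).2 ⟨_, _, hs, hx₁, h⟩) hd hp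

end Path

/-- The relation on `P` given by paths between the states that represent elements of `P`. -/
def Exec {P S : Type} (X : P → S → Prop) (E c : S → S → Prop) (p q : P) : Prop :=
  ∃ s t, X p s ∧ X q t ∧ Path E c s t

namespace Exec

variable {P Q S T : Type} {X : P → S → Prop} {E c : S → S → Prop}

theorem map (j : P → Q) :
    Relation.Map (Exec X E c) j j = Exec (fun q s => ∃ p, j p = q ∧ X p s) E c := by
  ext p q
  constructor
  · rintro ⟨p, q, ⟨s, t, hp, hq, h⟩, rfl, rfl⟩
    exact ⟨s, t, ⟨p, rfl, hp⟩, ⟨q, rfl, hq⟩, h⟩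
  · rintro ⟨s, t, ⟨p, rfl, hp⟩, ⟨q, rfl, hq⟩, h⟩
    exact ⟨p, q, ⟨s, t, hp, hq, h⟩, rfl, rfl⟩

theorem embed {E' c' : T → T → Prop} {i : T → S}
    (hE : ∀ s u, E (i s) u ↔ ∃ t, u = i t ∧ E' s t)
    (hc : ∀ s u, c (i s) u ↔ ∃ t, u = i t ∧ c' s t)
    (hr : ∀ s u, E s u → ∃ t, s = i t) :
    Exec X E c = Exec (fun p s => X p (i s)) E' c' := by
  ext p q
  constructor
  · rintro ⟨s, t, hp, hq, h⟩
    obtain ⟨a, ha⟩ := h.exists_head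
    obtain ⟨s, rfl⟩ := hr _ _ ha
    obtain ⟨t, rfl, h'⟩ := (Path.embed hE hc).1 h
    exact ⟨s, t, hp, hq, h'⟩
  · rintro ⟨s, t, hp, hq, h⟩
    exact ⟨_, _, hp, hq, (Path.embed hE hc).2 ⟨_, rfl, h⟩⟩

theorem nest {c₁ c₂ : S → S → Prop} {H d : T → T → Prop} {J : T → S → Prop} {X : P → T → Prop}
    (hH : H = Exec J E c₁)
    (h₁ : ∀ x y s t, d x y → J x s → J y t → (∃ a, E a s) → (∃ a, E t a) → c₂ s t)
    (h₂ : ∀ s t, c₂ s t → ∃ x y, d x y ∧ J x s ∧ J y t) :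
    Exec X H d = Exec (Relation.Comp X J) E (fun a b => c₁ a b ∨ c₂ a b) := by
  subst hH
  ext p q
  constructor
  · rintro ⟨x, y, hx, hy, h⟩
    obtain ⟨s, t, hs, ht, h⟩ := (Path.nest (fun _ _ => Iff.rfl) h₁ h₂).1 h
    exact ⟨s, t, ⟨x, hx, hs⟩, ⟨y, hy, ht⟩, h⟩
  · rintro ⟨s, t, ⟨x, hx, hs⟩, ⟨y, hy, ht⟩, h⟩
    exact ⟨x, y, hx, hy, (Path.nest (fun _ _ => Iff.rfl) h₁ h₂).2 ⟨s, t, hs, ht, h⟩⟩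

/-- Only the representatives that take part in `E` matter. -/
theorem congr {X' : P → S → Prop}
    (h : ∀ p s, (∃ a, E s a ∨ E a s) → (X p s ↔ X' p s)) : Exec X E c = Exec X' E c := by
  ext p q
  refine exists_congr fun s => exists_congr fun t => ?_
  by_cases hst : Path E c s t
  · rw [h p s (hst.exists_head.imp fun _ => Or.inl), h q t (hst.exists_last.imp fun _ => Or.inr)]
  · simp [hst]

end Exec

/-! ### Relations with ports -/

/-- The points at which a relation with ports in `V` can be entered or left. -/
inductive Pt (V : Type) where
  | out (x : Move) : Pt V
  | port (v : V) (x : Move) : Pt V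

/-- Relations with ports in `V`, the meanings of terms with free variables in `V`. -/
abbrev PRel (V : Type) := Pt V → Pt V → Prop

namespace Pt

variable {V W : Type}

/-- Renaming of ports. -/
def map (f : V → W) : Pt V → Pt W
  | out x => out x
  | port v x => port (f v) x

/-- The port `none` becomes the argument of the output. -/
def curry : Pt (Option V) → Pt V
  | out x => out (.r x)
  | port none x => out (.l x)
  | port (some v) x => port v x

theorem map_injective {f : V → W} (hf : f.Injective) : (map f).Injective := by
  rintro (_ | _) (_ | _) h <;> simp_all [map, hf.eq_iff]

theorem curry_injective : (curry (V := V)).Injective := by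
  rintro (_ | ⟨_ | _, _⟩) (_ | ⟨_ | _, _⟩) h <;> simp_all [curry]

theorem curry_map (f : V → W) (p : Pt (Option V)) :
    (p.map (Option.map f)).curry = p.curry.map f := by
  rcases p with _ | ⟨_ | _, _⟩ <;> rfl

end Pt

namespace PRel

open Pt Move

variable {V W : Type}

/-- The port `v`, wired to the output. -/
inductive wire (v : V) : PRel V
  | inward (x : Move) : wire v (out x) (port v x)
  | outward (x : Move) : wire v (port v x) (out x)

/-- A relation without ports. -/
inductive const (a : Move → Move → Prop) : PRel V
  | mk {x y : Move} : a x y → const a (out x) (out y)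

/-- Renaming of ports. -/
def rename (f : V → W) (F : PRel V) : PRel W := Relation.Map F (Pt.map f) (Pt.map f)

/-- Abstraction of the port `none`. -/
def curry (F : PRel (Option V)) : PRel V := Relation.Map F Pt.curry Pt.curry

/-- The links between a function and its argument. -/
inductive AppLink : Pt V ⊕ Pt V → Pt V ⊕ Pt V → Prop
  | right (x : Move) : AppLink (.inl (out (l x))) (.inr (out x))
  | left (x : Move) : AppLink (.inr (out x)) (.inl (out (l x)))

/-- The points of an application, and where they lie in the function or the argument. -/
inductive AppExt : Pt V → Pt V ⊕ Pt V → Prop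
  | out (x : Move) : AppExt (out x) (.inl (out (r x)))
  | left (v : V) (x : Move) : AppExt (port v x) (.inl (port v x))
  | right (v : V) (x : Move) : AppExt (port v x) (.inr (port v x))

/-- Linear application. -/
def app (F G : PRel V) : PRel V := Exec AppExt (Sum.LiftRel F G) AppLink

/-- The links between the port `w` of a relation and the output of another one. -/
inductive CutLink (w : V) : Pt V ⊕ Pt V → Pt V ⊕ Pt V → Prop
  | right (x : Move) : CutLink w (.inl (port w x)) (.inr (out x))
  | left (x : Move) : CutLink w (.inr (out x)) (.inl (port w x))

/-- The points of the result of plugging a relation into the port `w` of another one. -/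
inductive CutExt (w : V) : Pt V → Pt V ⊕ Pt V → Prop
  | out (x : Move) : CutExt w (out x) (.inl (out x))
  | left (v : V) (x : Move) : v ≠ w → CutExt w (port v x) (.inl (port v x))
  | right (v : V) (x : Move) : v ≠ w → CutExt w (port v x) (.inr (port v x))

/-- Plugging `G` into the port `w` of `F`. -/
def cut (w : V) (F G : PRel V) : PRel V :=
  Exec (CutExt w) (Sum.LiftRel F G) (CutLink w)

/-- The port `w` is not used. -/
def Fresh (w : V) (F : PRel V) : Prop := ∀ p q x, F p q → p ≠ port w x ∧ q ≠ port w x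

theorem liftRel_map {P Q P' Q' : Type} {i : P → Q} {j : P' → Q'} (hi : i.Injective)
    (hj : j.Injective) {F : P → P → Prop} {G : P' → P' → Prop} (s : P ⊕ P') (u : Q ⊕ Q') :
    Sum.LiftRel (Relation.Map F i i) (Relation.Map G j j) (Sum.map i j s) u ↔
      ∃ t, u = Sum.map i j t ∧ Sum.LiftRel F G s t := by
  rcases s with s | s <;> rcases u with u | u <;>
    simp [Relation.Map, hi.eq_iff, hj.eq_iff, and_comm, eq_comm]

theorem exists_of_liftRel_map {P Q P' Q' : Type} {i : P → Q} {j : P' → Q'}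
    {F : P → P → Prop} {G : P' → P' → Prop} (s u : Q ⊕ Q')
    (h : Sum.LiftRel (Relation.Map F i i) (Relation.Map G j j) s u) : ∃ t, s = Sum.map i j t := by
  rcases h with ⟨x, _, _, rfl, rfl⟩ | ⟨x, _, _, rfl, rfl⟩
  · exact ⟨.inl x, rfl⟩
  · exact ⟨.inr x, rfl⟩

/-- Execution of two relations that are carried by injective maps. -/
theorem exec_liftRel_map {P Q P' Q' Z : Type} {i : P → Q} {j : P' → Q'} (hi : i.Injective)
    (hj : j.Injective) {F : P → P → Prop} {G : P' → P' → Prop} {X : Z → Q ⊕ Q' → Prop}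
    {c : Q ⊕ Q' → Q ⊕ Q' → Prop} {c' : P ⊕ P' → P ⊕ P' → Prop}
    (hc : ∀ s u, c (Sum.map i j s) u ↔ ∃ t, u = Sum.map i j t ∧ c' s t) :
    Exec X (Sum.LiftRel (Relation.Map F i i) (Relation.Map G j j)) c =
      Exec (fun p s => X p (Sum.map i j s)) (Sum.LiftRel F G) c' :=
  Exec.embed (liftRel_map hi hj) hc exists_of_liftRel_map

end PRel
end StrictLambda

/-! ### Renaming, abstraction and plugging -/

namespace StrictLambda
namespace PRel

open Pt Move

variable {V W : Type}

theorem rename_app {f : V → W} (hf : f.Injective) (F G : PRel V) :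
    rename f (app F G) = app (rename f F) (rename f G) := by
  unfold app rename
  rw [Exec.map, exec_liftRel_map (map_injective hf) (map_injective hf) (c' := AppLink)]
  · congr! 3 with p s
    constructor
    · rintro ⟨p, rfl, h⟩
      cases h <;> constructor
    · intro h
      rcases s with (x | x) | (x | x) <;> cases h
      · exact ⟨out _, rfl, .out _⟩
      · exact ⟨port _ _, rfl, .left _ _⟩
      · exact ⟨port _ _, rfl, .right _ _⟩
  · intro s u
    constructor
    · intro h
      rcases s with (x | x) | (x | x) <;> cases h
      · exact ⟨_, rfl, .right _⟩
      · exact ⟨_, rfl, .left _⟩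
    · rintro ⟨t, rfl, h | h⟩
      · exact .right _
      · exact .left _

/-- The links of a cut, between relations with different ports. -/
inductive WeakCutLink (w : Option V) : Pt (Option V) ⊕ Pt V → Pt (Option V) ⊕ Pt V → Prop
  | right (x : Move) : WeakCutLink w (.inl (port w x)) (.inr (out x))
  | left (x : Move) : WeakCutLink w (.inr (out x)) (.inl (port w x))

/-- A normal form with unrenamed states for `G`, to which both sides of `cut_curry` and of
`rename_some_app_curry` are reduced. -/
theorem cut_rename_some (w : Option V) (F : PRel (Option V)) (G : PRel V) :
    cut w F (rename some G) = Exec (fun p s => CutExt w p (Sum.map id (Pt.map some) s))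
      (Sum.LiftRel F G) (WeakCutLink w) := by
  have h := exec_liftRel_map (F := F) (G := G) (X := CutExt w) (c := CutLink w)
    (c' := WeakCutLink w) Function.injective_id (map_injective (Option.some_injective V))
  rw [Relation.map_id_id] at h
  apply h
  intro s u
  constructor
  · intro h
    rcases s with (x | x) | (x | x) <;> cases h
    · exact ⟨_, rfl, .right _⟩
    · exact ⟨.inl (port _ _), rfl, .left _⟩
  · rintro ⟨t, rfl, h | h⟩
    · exact .right _
    · exact .left _

/-- Abstraction readdresses only the output and the port `none`, so it does not disturb the links at
`w`; the plugged relation is weakened by the new port. -/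
theorem cut_curry (w : V) (F : PRel (Option V)) (G : PRel V) :
    cut w (curry F) G = curry (cut (some w) F (rename some G)) := by
  rw [cut_rename_some, curry, curry, Exec.map]
  have h := exec_liftRel_map (F := F) (G := G) (X := CutExt w) (c := CutLink w)
    (c' := WeakCutLink (some w)) curry_injective Function.injective_id
  rw [Relation.map_id_id] at h
  rw [cut, h]
  · congr! 3 with p s
    constructor
    · intro h
      rcases s with (x | ⟨_ | v, x⟩) | (x | ⟨v, x⟩) <;> cases h
      · exact ⟨out _, rfl, .out _⟩
      · exact ⟨port none _, rfl, .left _ _ nofun⟩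
      · exact ⟨port (some v) _, rfl, .left _ _ (by simpa)⟩
      · exact ⟨port (some v) _, rfl, .right _ _ (by simpa)⟩
    · rintro ⟨p, rfl, h⟩
      rcases s with (x | ⟨_ | v, x⟩) | (x | ⟨v, x⟩) <;> cases h
      · exact .out _
      · exact .out _
      · exact .left _ _ (by simp_all)
      · exact .right _ _ (by simp_all)
  · intro s u
    constructor
    · intro h
      rcases s with (x | ⟨_ | v, x⟩) | (x | x) <;> cases h
      · exact ⟨.inr (out _), rfl, .right _⟩
      · exact ⟨.inl (port (some w) _), rfl, .left _⟩
    · rintro ⟨t, rfl, h | h⟩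
      · exact .right _
      · exact .left _

/-- The core of β: the `l` half of the output of `curry F` is the port `none` of `F` and the `r`
half is its output, so the links of the application are those of the cut. The renaming is needed
because the cut lives over the larger set of ports. -/
theorem rename_some_app_curry (F : PRel (Option V)) (G : PRel V) :
    rename some (app (curry F) G) = cut none F (rename some G) := by
  rw [cut_rename_some, rename, curry]
  have h := exec_liftRel_map (F := F) (G := G) (X := AppExt) (c := AppLink)
    (c' := WeakCutLink none) curry_injective Function.injective_id
  rw [Relation.map_id_id] at h
  rw [app, h, Exec.map]
  · congr! 3 with p s
    constructor
    · rintro ⟨p, rfl, h⟩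
      rcases s with (x | ⟨_ | v, x⟩) | (x | ⟨v, x⟩) <;> cases h
      · exact .out _
      · exact .left _ _ (by simp)
      · exact .right _ _ (by simp)
    · intro h
      rcases s with (x | ⟨_ | v, x⟩) | (x | ⟨v, x⟩) <;> cases h
      · exact ⟨out _, rfl, .out _⟩
      · contradiction
      · exact ⟨port v _, rfl, .left _ _⟩
      · exact ⟨port v _, rfl, .right _ _⟩
  · intro s u
    constructor
    · intro h
      rcases s with (x | ⟨_ | v, x⟩) | (x | x) <;> cases h
      · exact ⟨.inr (out _), rfl, .right _⟩
      · exact ⟨.inl (port none _), rfl, .left _⟩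
    · rintro ⟨t, rfl, h | h⟩
      · exact .right _
      · exact .left _

theorem rename_injective {f : V → W} (hf : f.Injective) : (rename f).Injective := by
  intro F G h
  ext p q
  have := congr_fun₂ h (p.map f) (q.map f)
  simpa [rename, Relation.Map, (map_injective hf).eq_iff] using this

theorem rename_curry (f : V → W) (F : PRel (Option V)) :
    rename f (curry F) = curry (rename (Option.map f) F) := by
  simp only [rename, curry, Relation.map_map]
  congr 1 <;> ext p <;> exact (curry_map f p).symm

theorem rename_rename {U : Type} (f : V → W) (g : W → U) (F : PRel V) :
    rename g (rename f F) = rename (g ∘ f) F := by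
  simp only [rename, Relation.map_map]
  congr 1 <;> ext p <;> cases p <;> rfl

theorem rename_wire (f : V → W) (v : V) : rename f (wire v) = wire (f v) := by
  ext p q
  constructor
  · rintro ⟨p, q, h | h, rfl, rfl⟩ <;> constructor
  · rintro (h | h)
    · exact ⟨_, _, .inward _, rfl, rfl⟩
    · exact ⟨_, _, .outward _, rfl, rfl⟩

theorem rename_const (f : V → W) (a : Move → Move → Prop) : rename f (const a) = const a := by
  ext p q
  constructor
  · rintro ⟨p, q, ⟨h⟩, rfl, rfl⟩
    exact .mk h
  · rintro ⟨h⟩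
    exact ⟨_, _, .mk h, rfl, rfl⟩

theorem fresh_const (w : V) (a : Move → Move → Prop) : Fresh w (const a) := by
  rintro _ _ x ⟨h⟩
  simp

theorem fresh_wire {v w : V} (h : v ≠ w) : Fresh w (wire v) := by
  rintro _ _ x (_ | _) <;> simp [h]

theorem Fresh.app {w : V} {F G : PRel V} (hF : Fresh w F) (hG : Fresh w G) :
    Fresh w (app F G) := by
  rintro p q x ⟨s, t, hp, hq, h⟩
  obtain ⟨a, ha⟩ := h.exists_head
  obtain ⟨b, hb⟩ := h.exists_last
  constructor
  · rintro rfl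
    cases hp <;> cases ha
    · exact (hF _ _ x ‹_›).1 rfl
    · exact (hG _ _ x ‹_›).1 rfl
  · rintro rfl
    cases hq <;> cases hb
    · exact (hF _ _ x ‹_›).2 rfl
    · exact (hG _ _ x ‹_›).2 rfl

theorem Fresh.curry {w : V} {F : PRel (Option V)} (hF : Fresh (some w) F) : Fresh w (curry F) := by
  rintro _ _ x ⟨p, q, h, rfl, rfl⟩
  have := hF _ _ x h
  rcases p with _ | ⟨_ | _, _⟩ <;> rcases q with _ | ⟨_ | _, _⟩ <;> simp_all [Pt.curry]

theorem Fresh.rename {w : V} {F : PRel V} (hF : Fresh w F) {f : V → W} (hf : f.Injective) :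
    Fresh (f w) (rename f F) := by
  rintro _ _ x ⟨p, q, h, rfl, rfl⟩
  have := hF _ _ x h
  rcases p with _ | _ <;> rcases q with _ | _ <;> simp_all [Pt.map, hf.eq_iff]

theorem fresh_rename {w : W} (F : PRel V) {f : V → W} (hf : ∀ v, f v ≠ w) :
    Fresh w (rename f F) := by
  rintro _ _ x ⟨p, q, h, rfl, rfl⟩
  rcases p with _ | _ <;> rcases q with _ | _ <;> simp_all [Pt.map]

end PRel
end StrictLambda

/-! ### Associativity of execution: plugging commutes with application -/

namespace StrictLambda

namespace Exec

variable {P Q S T : Type} {X : P → S → Prop} {E c : S → S → Prop} {H : Q → Q → Prop}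
  {E' : T → T → Prop} {i : S → T} {k : Q → T}

theorem of_embed (hi : i.Injective) (hE : ∀ s u, E' (i s) u ↔ ∃ t, u = i t ∧ E s t) :
    Exec X E c = Exec (fun p u => ∃ s, X p s ∧ i s = u) E' (Relation.Map c i i) := by
  have hc (s u) : Relation.Map c i i (i s) u ↔ ∃ t, u = i t ∧ c s t := by
    simp [Relation.Map, hi.eq_iff, and_comm, eq_comm]
  ext p q
  constructor
  · rintro ⟨s, t, hp, hq, h⟩
    exact ⟨_, _, ⟨s, hp, rfl⟩, ⟨t, hq, rfl⟩, (Path.embed hE hc).2 ⟨_, rfl, h⟩⟩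
  · rintro ⟨_, _, ⟨s, hp, rfl⟩, ⟨t, hq, rfl⟩, h⟩
    obtain ⟨t', ht, h⟩ := (Path.embed hE hc).1 h
    cases hi ht
    exact ⟨s, t, hp, hq, h⟩

/-- A relation side by side with an execution, as an execution in a larger space of states. -/
theorem liftRel_left (hi : i.Injective) (hk : k.Injective) (hik : ∀ s q, i s ≠ k q)
    (hE : ∀ s u, E' (i s) u ↔ ∃ t, u = i t ∧ E s t)
    (hH : ∀ q u, E' (k q) u ↔ ∃ t, u = k t ∧ H q t) :
    Sum.LiftRel (Exec X E c) H =
      Exec (Sum.elim (fun p u => ∃ s, X p s ∧ i s = u) (fun q u => k q = u)) E'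
        (Relation.Map c i i) := by
  have hc (s u) : Relation.Map c i i (i s) u ↔ ∃ t, u = i t ∧ c s t := by
    simp [Relation.Map, hi.eq_iff, and_comm, eq_comm]
  have hc' (q u) : ¬ Relation.Map c i i (k q) u := by
    rintro ⟨s, _, _, h, _⟩
    exact hik _ _ h
  ext p q
  constructor
  · rintro (h | h)
    · rwa [of_embed hi hE] at h
    · exact ⟨_, _, rfl, rfl, (Path.embed_of_no_link hH hc').2 ⟨_, rfl, h⟩⟩
  · rintro ⟨s, t, hp, hq, h⟩
    rcases p with p | p <;> rcases q with q | q
    · refine .inl ?_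
      rw [of_embed hi hE]
      exact ⟨s, t, hp, hq, h⟩
    · obtain ⟨s, hp, rfl⟩ := hp
      obtain ⟨t, rfl, _⟩ := (Path.embed hE hc).1 h
      exact (hik _ _ hq.symm).elim
    · cases hp
      obtain ⟨t', rfl, _⟩ := (Path.embed_of_no_link hH hc').1 h
      obtain ⟨t, _, ht⟩ := hq
      exact (hik _ _ ht).elim
    · cases hp
      cases hq
      obtain ⟨t', ht, h⟩ := (Path.embed_of_no_link hH hc').1 h
      cases hk ht
      exact .inr h

/-- The variant of `liftRel_left` with the execution on the right. -/
theorem liftRel_right (hi : i.Injective) (hk : k.Injective) (hik : ∀ s q, i s ≠ k q)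
    (hE : ∀ s u, E' (i s) u ↔ ∃ t, u = i t ∧ E s t)
    (hH : ∀ q u, E' (k q) u ↔ ∃ t, u = k t ∧ H q t) :
    Sum.LiftRel H (Exec X E c) =
      Exec (Sum.elim (fun q u => k q = u) (fun p u => ∃ s, X p s ∧ i s = u)) E'
        (Relation.Map c i i) := by
  have h := liftRel_left (X := X) (c := c) hi hk hik hE hH
  ext p q
  have h' := congr_fun₂ h p.swap q.swap
  rw [Sum.liftRel_swap_iff] at h'
  rw [h']
  rcases p with p | p <;> rcases q with q | q <;> rfl

end Exec

namespace PRel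

open Pt Move

variable {V : Type}

/-- Plugging into the function of an application. -/
theorem cut_app_left {w : V} (F : PRel V) {G : PRel V} (hG : Fresh w G) (H : PRel V) :
    cut w (app F G) H = app (cut w F H) G := by
  -- Both sides are flattened to executions over the three relations at once. Here `i` embeds the
  -- pair `F`, `G` and `j` the pair `F`, `H`; the links agree up to order.
  set E : Pt V ⊕ Pt V ⊕ Pt V → Pt V ⊕ Pt V ⊕ Pt V → Prop := Sum.LiftRel F (Sum.LiftRel G H)
  let i : Pt V ⊕ Pt V → Pt V ⊕ Pt V ⊕ Pt V := Sum.map id .inl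
  let j : Pt V ⊕ Pt V → Pt V ⊕ Pt V ⊕ Pt V := Sum.map id .inr
  have hi : i.Injective := Function.injective_id.sumMap Sum.inl_injective
  have hj : j.Injective := Function.injective_id.sumMap Sum.inr_injective
  unfold cut app
  rw [Exec.nest (c₂ := Relation.Map (CutLink w) j j)
      (Exec.liftRel_left (E' := E) (i := i) (k := Sum.inr ∘ Sum.inr) hi
        (Sum.inr_injective.comp Sum.inr_injective) (by rintro (s | s) q <;> simp [i])
        (by rintro (s | s) (u | u | u) <;> simp [i, E])
        (by rintro s (u | u | u) <;> simp [E])),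
    Exec.nest (c₂ := Relation.Map AppLink i i)
      (Exec.liftRel_left (E' := E) (i := j) (k := Sum.inr ∘ Sum.inl) hj
        (Sum.inr_injective.comp Sum.inl_injective) (by rintro (s | s) q <;> simp [j])
        (by rintro (s | s) (u | u | u) <;> simp [j, E])
        (by rintro s (u | u | u) <;> simp [E]))]
  · simp only [or_comm]
    refine Exec.congr fun p s ⟨a, hs⟩ => ?_
    constructor
    · rintro ⟨_, h, h'⟩
      cases h
      · obtain ⟨_, h', rfl⟩ := h'
        cases h'
        exact ⟨_, .out _, _, .out _, rfl⟩
      · obtain ⟨_, h', rfl⟩ := h'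
        cases h'
        · exact ⟨_, .left _ _, _, .left _ _ ‹_›, rfl⟩
        · exact ⟨_, .right _ _, rfl⟩
      · cases h'
        exact ⟨_, .left _ _, _, .right _ _ ‹_›, rfl⟩
    · rintro ⟨_, h, h'⟩
      cases h
      · obtain ⟨_, h', rfl⟩ := h'
        cases h'
        exact ⟨_, .out _, _, .out _, rfl⟩
      · obtain ⟨_, h', rfl⟩ := h'
        cases h'
        · exact ⟨_, .left _ _ ‹_›, _, .left _ _, rfl⟩
        · exact ⟨_, .right _ _ ‹_›, rfl⟩
      · cases h'
        refine ⟨_, .left _ _ ?_, _, .right _ _, rfl⟩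
        -- A point at port `w` of `G` represents a point on one side only, but freshness says that
        -- no step of `E` touches it.
        rintro rfl
        rcases a with a | a | a <;> simp [E] at hs
        rcases hs with hs | hs
        · exact (hG _ _ _ hs).1 rfl
        · exact (hG _ _ _ hs).2 rfl
  · rintro _ _ s t (x | x) hs ht ha hb
    · obtain ⟨_, hs, rfl⟩ := hs
      cases ht
      cases hs
      exact ⟨_, _, .right _, rfl, rfl⟩
    · obtain ⟨_, ht, rfl⟩ := ht
      cases hs
      cases ht
      exact ⟨_, _, .left _, rfl, rfl⟩
  · rintro _ _ ⟨_, _, h | h, rfl, rfl⟩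
    · exact ⟨_, _, .right _, ⟨_, .out _, rfl⟩, rfl⟩
    · exact ⟨_, _, .left _, rfl, ⟨_, .out _, rfl⟩⟩
  · rintro _ _ s t (x | x) hs ht ⟨a, ha⟩ ⟨b, hb⟩
    · obtain ⟨_, hs, rfl⟩ := hs
      cases ht
      cases hs
      · exact ⟨_, _, .right _, rfl, rfl⟩
      -- The port `w` of the application could also lie in its argument; freshness of `G` excludes
      -- this.
      · rcases a with a | a | a <;> simp [E, i] at ha
        exact ((hG _ _ _ ha).2 rfl).elim
    · obtain ⟨_, ht, rfl⟩ := ht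
      cases hs
      cases ht
      · exact ⟨_, _, .left _, rfl, rfl⟩
      · rcases b with b | b | b <;> simp [E, i] at hb
        exact ((hG _ _ _ hb).1 rfl).elim
  · rintro _ _ ⟨_, _, h | h, rfl, rfl⟩
    · exact ⟨_, _, .right _, ⟨_, .left _ _, rfl⟩, rfl⟩
    · exact ⟨_, _, .left _, rfl, ⟨_, .left _ _, rfl⟩⟩

/-- Plugging into the argument of an application. -/
theorem cut_app_right {w : V} {F : PRel V} (hF : Fresh w F) (G H : PRel V) :
    cut w (app F G) H = app F (cut w G H) := by
  -- The same flattening, now with `G` and `H` as the inner pair embedded by `j`.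
  set E : Pt V ⊕ Pt V ⊕ Pt V → Pt V ⊕ Pt V ⊕ Pt V → Prop := Sum.LiftRel F (Sum.LiftRel G H)
  let i : Pt V ⊕ Pt V → Pt V ⊕ Pt V ⊕ Pt V := Sum.map id .inl
  let j : Pt V ⊕ Pt V → Pt V ⊕ Pt V ⊕ Pt V := .inr
  have hi : i.Injective := Function.injective_id.sumMap Sum.inl_injective
  unfold cut app
  rw [Exec.nest (c₂ := Relation.Map (CutLink w) j j)
      (Exec.liftRel_left (E' := E) (i := i) (k := Sum.inr ∘ Sum.inr) hi
        (Sum.inr_injective.comp Sum.inr_injective) (by rintro (s | s) q <;> simp [i])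
        (by rintro (s | s) (u | u | u) <;> simp [i, E])
        (by rintro s (u | u | u) <;> simp [E])),
    Exec.nest (c₂ := Relation.Map AppLink i i)
      (Exec.liftRel_right (E' := E) (i := j) (k := Sum.inl) Sum.inr_injective
        Sum.inl_injective (by rintro (s | s) q <;> simp [j])
        (by rintro (s | s) (u | u | u) <;> simp [j, E])
        (by rintro s (u | u | u) <;> simp [E]))]
  · simp only [or_comm]
    refine Exec.congr fun p s ⟨a, hs⟩ => ?_
    constructor
    · rintro ⟨_, h, h'⟩
      cases h
      · obtain ⟨_, h', rfl⟩ := h'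
        cases h'
        exact ⟨_, .out _, rfl⟩
      · obtain ⟨_, h', rfl⟩ := h'
        cases h'
        · exact ⟨_, .left _ _, rfl⟩
        · exact ⟨_, .right _ _, _, .left _ _ ‹_›, rfl⟩
      · cases h'
        exact ⟨_, .right _ _, _, .right _ _ ‹_›, rfl⟩
    · rintro ⟨_, h, h'⟩
      cases h
      · cases h'
        exact ⟨_, .out _, _, .out _, rfl⟩
      · cases h'
        refine ⟨_, .left _ _ ?_, _, .left _ _, rfl⟩
        rintro rfl
        rcases a with a | a | a <;> simp [E] at hs
        rcases hs with hs | hs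
        · exact (hF _ _ _ hs).1 rfl
        · exact (hF _ _ _ hs).2 rfl
      · obtain ⟨_, h', rfl⟩ := h'
        cases h'
        · exact ⟨_, .left _ _ ‹_›, _, .right _ _, rfl⟩
        · exact ⟨_, .right _ _ ‹_›, rfl⟩
  · rintro _ _ s t (x | x) hs ht ha hb
    · obtain ⟨_, ht, rfl⟩ := ht
      cases hs
      cases ht
      exact ⟨_, _, .right _, rfl, rfl⟩
    · obtain ⟨_, hs, rfl⟩ := hs
      cases ht
      cases hs
      exact ⟨_, _, .left _, rfl, rfl⟩
  · rintro _ _ ⟨_, _, h | h, rfl, rfl⟩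
    · exact ⟨_, _, .right _, rfl, ⟨_, .out _, rfl⟩⟩
    · exact ⟨_, _, .left _, ⟨_, .out _, rfl⟩, rfl⟩
  · rintro _ _ s t (x | x) hs ht ⟨a, ha⟩ ⟨b, hb⟩
    · obtain ⟨_, hs, rfl⟩ := hs
      cases ht
      cases hs
      · rcases a with a | a | a <;> simp [E, i] at ha
        exact ((hF _ _ _ ha).2 rfl).elim
      · exact ⟨_, _, .right _, rfl, rfl⟩
    · obtain ⟨_, ht, rfl⟩ := ht
      cases hs
      cases ht
      · rcases b with b | b | b <;> simp [E, i] at hb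
        exact ((hF _ _ _ hb).1 rfl).elim
      · exact ⟨_, _, .left _, rfl, rfl⟩
  · rintro _ _ ⟨_, _, h | h, rfl, rfl⟩
    · exact ⟨_, _, .right _, ⟨_, .right _ _, rfl⟩, rfl⟩
    · exact ⟨_, _, .left _, rfl, ⟨_, .right _ _, rfl⟩⟩

/-- Plugging into a wire. -/
theorem cut_wire {w : V} {G : PRel V} (hG : Fresh w G) : cut w (wire w) G = G := by
  -- The start decides the whole path: the wire sends port `w` to the output, where the path ends,
  -- and the output to port `w`, from which `G` is entered.
  have hout {s t} (h : Path (Sum.LiftRel (wire w) G) (CutLink w) s t) :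
      (∀ x, s = .inl (port w x) → t = .inl (out x)) ∧
      (∀ p q, s = .inr p → CutExt w q t → G p q) ∧
      (∀ x q, s = .inl (out x) → CutExt w q t → G (out x) q) := by
    induction h with
    | single h =>
      refine ⟨?_, ?_, ?_⟩
      · rintro x rfl
        rcases h with h | h
        cases h
        rfl
      · rintro p q rfl ht
        rcases h with h | h
        cases ht
        exact h
      · rintro x q rfl ht
        rcases h with h | h
        cases h
        cases ht
        contradiction
    | cons h hc _ ih =>
      obtain ⟨ih1, ih2, ih3⟩ := ih
      refine ⟨?_, ?_, ?_⟩
      · rintro x rfl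
        rcases h with h | h
        cases h
        cases hc
      · rintro p q rfl ht
        rcases h with _ | h
        cases hc
        cases ih1 _ rfl
        cases ht
        exact h
      · rintro x q rfl ht
        rcases h with h | h
        cases h
        cases hc
        exact ih2 _ _ rfl ht
  ext p q
  constructor
  · rintro ⟨s, t, hp, hq, h⟩
    cases hp
    · exact (hout h).2.2 _ _ rfl hq
    · obtain ⟨a, ha⟩ := h.exists_head
      cases ha
      cases ‹wire w _ _›
      contradiction
    · exact (hout h).2.1 _ _ rfl hq
  · intro h
    have hp (x) := (hG _ _ x h).1
    have hq (x) := (hG _ _ x h).2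
    have h' : Sum.LiftRel (wire w) G (.inr p) (.inr q) := .inr h
    rcases p with x | ⟨v, x⟩ <;> rcases q with y | ⟨u, y⟩
    · exact ⟨_, _, .out _, .out _, .cons (.inl (.inward _)) (.right _)
        (.cons h' (.left _) (.single (.inl (.outward _))))⟩
    · exact ⟨_, _, .out _, .right _ _ (by simp_all), .cons (.inl (.inward _)) (.right _)
        (.single h')⟩
    · exact ⟨_, _, .right _ _ (by simp_all), .out _,
        .cons h' (.left _) (.single (.inl (.outward _)))⟩
    · exact ⟨_, _, .right _ _ (by simp_all), .right _ _ (by simp_all), .single h'⟩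

end PRel
end StrictLambda

/-! ### Application to wires, and application without ports -/

namespace StrictLambda

namespace PRel

open Pt Move

variable {V : Type}

/-- How the points of a function appear after application to the wire `v`. -/
inductive ArgPt (v : V) : Pt V → Pt V → Prop
  | out (x : Move) : ArgPt v (out (r x)) (out x)
  | arg (x : Move) : ArgPt v (out (l x)) (port v x)
  | port (u : V) (x : Move) : ArgPt v (port u x) (port u x)

/-- A wire as argument only relabels `F`: a path that leaves `F` at `l x` crosses the wire and stops
at its port, so `F` is used exactly once. -/
theorem app_wire_right (F : PRel V) (v : V) (p q : Pt V) :
    app F (wire v) p q ↔ ∃ p' q', F p' q' ∧ ArgPt v p' p ∧ ArgPt v q' q := by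
  have hout {s t} (h : Path (Sum.LiftRel F (wire v)) AppLink s t) {q} (hq : AppExt q t) :
      (∀ p, s = .inl p → ∃ q', F p q' ∧ ArgPt v q' q) ∧
      (∀ x, s = .inr (out x) → q = port v x) ∧
      (∀ x, s = .inr (port v x) → ∃ q', F (out (l x)) q' ∧ ArgPt v q' q) := by
    induction h with
    | single h =>
      refine ⟨?_, ?_, ?_⟩
      · rintro p rfl
        rcases h with h | h
        cases hq
        · exact ⟨_, h, .out _⟩
        · exact ⟨_, h, .port _ _⟩
      · rintro x rfl
        rcases h with h | h
        cases h
        cases hq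
        rfl
      · rintro x rfl
        rcases h with h | h
        cases h
        cases hq
    | cons h hc _ ih =>
      obtain ⟨ih1, ih2, -⟩ := ih hq
      refine ⟨?_, ?_, ?_⟩
      · rintro p rfl
        rcases h with h | h
        cases hc
        cases ih2 _ rfl
        exact ⟨_, h, .arg _⟩
      · rintro x rfl
        rcases h with h | h
        cases h
        cases hc
      · rintro x rfl
        rcases h with h | h
        cases h
        cases hc
        exact ih1 _ rfl
  constructor
  · rintro ⟨s, t, hp, hq, h⟩
    cases hp with
    | out x =>
      obtain ⟨q', h, h'⟩ := (hout h hq).1 _ rfl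
      exact ⟨_, _, h, .out _, h'⟩
    | left u x =>
      obtain ⟨q', h, h'⟩ := (hout h hq).1 _ rfl
      exact ⟨_, _, h, .port _ _, h'⟩
    | right u x =>
      obtain ⟨a, ha⟩ := h.exists_head
      obtain rfl : v = u := by
        cases ha
        cases ‹wire v _ _›
        rfl
      obtain ⟨q', h, h'⟩ := (hout h hq).2.2 _ rfl
      exact ⟨_, _, h, .arg _, h'⟩
  · rintro ⟨p', q', h, hp, hq⟩
    have hend : ∃ t, AppExt q t ∧ Path (Sum.LiftRel F (wire v)) AppLink (.inl p') t := by
      cases hq with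
      | out x => exact ⟨_, .out _, .single (.inl h)⟩
      | arg x => exact ⟨_, .right _ _, .cons (.inl h) (.right _) (.single (.inr (.inward _)))⟩
      | port u x => exact ⟨_, .left _ _, .single (.inl h)⟩
    obtain ⟨t, hq, h⟩ := hend
    cases hp with
    | out x => exact ⟨_, _, .out _, hq, h⟩
    | arg x => exact ⟨_, _, .right _ _, hq, .cons (.inr (.outward _)) (.left _) h⟩
    | port u x => exact ⟨_, _, .left _ _, hq, h⟩

/-- How the points of an argument appear after application of the wire `v` to it. -/
inductive FunPt (v : V) : Pt V → Pt V → Prop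
  | out (x : Move) : FunPt v (out x) (port v (l x))
  | port (u : V) (x : Move) : FunPt v (port u x) (port u x)

/-- The wire shows its output at its port: the `r` half is the result of the application, the `l`
half leads into the argument. -/
theorem app_wire_left (v : V) (G : PRel V) (p q : Pt V) :
    app (wire v) G p q ↔ (∃ x, p = out x ∧ q = port v (r x) ∨ p = port v (r x) ∧ q = out x) ∨
      ∃ p' q', G p' q' ∧ FunPt v p' p ∧ FunPt v q' q := by
  have hout {s t} (h : Path (Sum.LiftRel (wire v) G) AppLink s t) {q} (hq : AppExt q t) :
      (∀ x, s = .inl (out x) → q = port v x) ∧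
      (∀ x, s = .inl (port v (r x)) → q = out x) ∧
      (∀ p, s = .inr p → ∃ q', G p q' ∧ FunPt v q' q) ∧
      (∀ x, s = .inl (port v (l x)) → ∃ q', G (out x) q' ∧ FunPt v q' q) := by
    induction h with
    | single h =>
      refine ⟨?_, ?_, ?_, ?_⟩
      · rintro x rfl
        rcases h with h | h
        cases h
        cases hq
        rfl
      · rintro x rfl
        rcases h with h | h
        cases h
        cases hq
        rfl
      · rintro p rfl
        rcases h with h | h
        cases hq
        exact ⟨_, h, .port _ _⟩
      · rintro x rfl
        rcases h with h | h
        cases h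
        cases hq
    | cons h hc _ ih =>
      obtain ⟨ih1, -, ih3, -⟩ := ih hq
      refine ⟨?_, ?_, ?_, ?_⟩
      · rintro x rfl
        rcases h with h | h
        cases h
        cases hc
      · rintro x rfl
        rcases h with h | h
        cases h
        cases hc
      · rintro p rfl
        rcases h with h | h
        cases hc
        cases ih1 _ rfl
        exact ⟨_, h, .out _⟩
      · rintro x rfl
        rcases h with h | h
        cases h
        cases hc
        exact ih3 _ rfl
  constructor
  · rintro ⟨s, t, hp, hq, h⟩
    cases hp with
    | out x => exact .inl ⟨x, .inl ⟨rfl, (hout h hq).1 _ rfl⟩⟩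
    | left u x =>
      obtain ⟨a, ha⟩ := h.exists_head
      obtain rfl : v = u := by
        cases ha
        cases ‹wire v _ _›
        rfl
      cases x with
      | r x => exact .inl ⟨x, .inr ⟨rfl, (hout h hq).2.1 _ rfl⟩⟩
      | l x =>
        obtain ⟨q', h, h'⟩ := (hout h hq).2.2.2 _ rfl
        exact .inr ⟨_, _, h, .out _, h'⟩
      -- The moves `e` and pairs at port `v` are carried to output points that are neither external
      -- nor linked.
      | _ =>
        cases h with
        | single h =>
          rcases h with h | h
          cases h
          cases hq
        | cons h hc _ =>
          rcases h with h | h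
          cases h
          cases hc
    | right u x =>
      obtain ⟨q', h, h'⟩ := (hout h hq).2.2.1 _ rfl
      exact .inr ⟨_, _, h, .port _ _, h'⟩
  · rintro (⟨x, ⟨rfl, rfl⟩ | ⟨rfl, rfl⟩⟩ | ⟨p', q', h, hp, hq⟩)
    · exact ⟨_, _, .out _, .left _ _, .single (.inl (.inward _))⟩
    · exact ⟨_, _, .left _ _, .out _, .single (.inl (.outward _))⟩
    · have hend : ∃ t, AppExt q t ∧ Path (Sum.LiftRel (wire v) G) AppLink (.inr p') t := by
        cases hq with
        | out x => exact ⟨_, .left _ _, .cons (.inr h) (.left _) (.single (.inl (.inward _)))⟩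
        | port u x => exact ⟨_, .right _ _, .single (.inr h)⟩
      obtain ⟨t, hq, h⟩ := hend
      cases hp with
      | out x => exact ⟨_, _, .left _ _, hq, .cons (.inl (.outward _)) (.right _) h⟩
      | port u x => exact ⟨_, _, .right _ _, hq, h⟩

theorem app_const (f g : PInv) :
    app (const f.rel) (const g.rel) = (const (PInv.app f g).rel : PRel V) := by
  -- The two clauses are the two phases of the loop in the execution formula: about to enter `g`, or
  -- about to enter `f`.
  have hout {s t} (h : Path (Sum.LiftRel (const f.rel) (const g.rel : PRel V)) AppLink s t)
      {v} (ht : t = .inl (out (r v))) :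
      (∀ x, s = .inr (out x) → ∃ y d, g.rel x y ∧ Relation.ReflTransGen
        (Relation.Comp (f.part .l .l) g.rel) y d ∧ f.rel (l d) (r v)) ∧
      (∀ x, s = .inl (out x) → f.rel x (r v) ∨ ∃ x' y d, f.rel x (l x') ∧ g.rel x' y ∧
        Relation.ReflTransGen (Relation.Comp (f.part .l .l) g.rel) y d ∧ f.rel (l d) (r v)) := by
    induction h with
    | single h =>
      subst ht
      refine ⟨?_, ?_⟩
      · rintro x rfl
        rcases h with h | h
      · rintro x rfl
        rcases h with h | h
        cases h with | mk h => exact .inl h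
    | cons h hc _ ih =>
      obtain ⟨ih1, ih2⟩ := ih ht
      refine ⟨?_, ?_⟩
      · rintro x rfl
        rcases h with _ | h
        cases h with | mk h =>
        cases hc
        rcases ih2 _ rfl with h' | ⟨x', y, d, h1, h2, h3, h4⟩
        · exact ⟨_, _, h, .refl, h'⟩
        · exact ⟨_, _, h, .head ⟨_, h1, h2⟩ h3, h4⟩
      · rintro x rfl
        rcases h with h | _
        cases h with | mk h =>
        cases hc
        obtain ⟨y, d, h'⟩ := ih1 _ rfl
        exact .inr ⟨_, _, _, h, h'⟩
  ext p q
  constructor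
  · rintro ⟨s, t, hp, hq, h⟩
    obtain ⟨a, ha⟩ := h.exists_head
    obtain ⟨b, hb⟩ := h.exists_last
    cases hp with
    | out x =>
      cases hq with
      | out y =>
        refine .mk ?_
        rcases (hout h rfl).2 _ rfl with h' | ⟨x', y, d, h1, h2, h3, h4⟩
        · exact .inl h'
        · exact .inr ⟨_, ⟨_, ⟨_, h1, h2⟩, h3⟩, h4⟩
      | left => cases hb; cases ‹const _ _ _›
      | right => cases hb; cases ‹const _ _ _›
    | left => cases ha; cases ‹const _ _ _›
    | right => cases ha; cases ‹const _ _ _›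
  · rintro ⟨h | ⟨d, ⟨b, ⟨a, h1, h2⟩, h3⟩, h4⟩⟩
    · exact ⟨_, _, .out _, .out _, .single (.inl (.mk h))⟩
    · refine ⟨_, _, .out _, .out _, .cons (.inl (.mk h1)) (.right _) ?_⟩
      clear h1
      induction h3 using Relation.ReflTransGen.head_induction_on generalizing a with
      | refl => exact .cons (.inr (.mk h2)) (.left _) (.single (.inl (.mk h4)))
      | head h _ ih =>
        obtain ⟨x, hx, hx'⟩ := h
        exact .cons (.inr (.mk h2)) (.left _) (.cons (.inl (.mk hx)) (.right _)
          (ih _ hx'))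

theorem const_injective {f g : PInv} (h : (const f.rel : PRel V) = const g.rel) : f = g := by
  ext x y
  have h' := congr_fun₂ h (out x) (out y)
  constructor
  · intro hx
    cases h' ▸ (const.mk hx : (const f.rel : PRel V) _ _)
    assumption
  · intro hx
    cases h'.symm ▸ (const.mk hx : (const g.rel : PRel V) _ _)
    assumption

end PRel

/-! ### Denotations of λ-terms and soundness of linear β -/

namespace LTerm

open PRel

variable {V W : Type}

/-- The environment moved under one binder, for which the port `none` is added. -/
def upEnv (ρ : ℕ → PRel V) : ℕ → PRel (Option V)
  | 0 => wire none
  | n + 1 => PRel.rename some (ρ n)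

/-- The meaning of a lambda term as a relation with ports. -/
def den : LTerm PInv → {V : Type} → (ℕ → PRel V) → PRel V
  | var n, _, ρ => ρ n
  | const a, _, _ => PRel.const a.rel
  | app M N, _, ρ => PRel.app (den M ρ) (den N ρ)
  | lam M, _, ρ => PRel.curry (den M (upEnv ρ))

/-- Lets a substituted term pass under a binder, where its denotation is weakened by the new port.
-/
theorem rename_den (M : LTerm PInv) {f : V → W} (hf : f.Injective) (ρ : ℕ → PRel V) :
    PRel.rename f (den M ρ) = den M (fun n => PRel.rename f (ρ n)) := by
  induction M generalizing V W with
  | var n => rfl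
  | const a => exact rename_const _ _
  | app M N ihM ihN => simp only [den, rename_app hf, ihM hf, ihN hf]
  | lam M ih =>
    simp only [den, rename_curry, ih (Option.map_injective hf)]
    congr 2
    ext1 n
    cases n with
    | zero => exact rename_wire _ _
    | succ n => simp only [upEnv, rename_rename]; rfl

theorem den_rename (M : LTerm PInv) (f : ℕ → ℕ) (ρ : ℕ → PRel V) :
    den (rename f M) ρ = den M (ρ ∘ f) := by
  induction M generalizing V f with
  | var n => rfl
  | const a => rfl
  | app M N ihM ihN => simp only [den, rename, ihM, ihN]
  | lam M ih =>
    simp only [den, rename, ih]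
    congr 2
    ext1 n
    cases n <;> rfl

theorem den_subst (M : LTerm PInv) (σ : ℕ → LTerm PInv) (ρ : ℕ → PRel V) :
    den (subst σ M) ρ = den M (fun n => den (σ n) ρ) := by
  induction M generalizing V σ with
  | var n => rfl
  | const a => rfl
  | app M N ihM ihN => simp only [den, subst, ihM, ihN]
  | lam M ih =>
    simp only [den, subst, ih]
    congr 2
    ext1 n
    cases n with
    | zero => rfl
    | succ n =>
      simp only [up, upEnv, den_rename, rename_den _ (Option.some_injective V)]
      rfl

theorem den_congr (M : LTerm PInv) {ρ ρ' : ℕ → PRel V} (h : ∀ n, occ n M ≠ 0 → ρ n = ρ' n) :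
    den M ρ = den M ρ' := by
  induction M generalizing V with
  | var n => exact h n (by simp [occ])
  | const a => rfl
  | app M N ihM ihN =>
    simp only [den]
    rw [ihM fun n hn => h n (by simp [occ, hn]), ihN fun n hn => h n (by simp [occ, hn])]
  | lam M ih =>
    simp only [den]
    rw [ih]
    rintro (_ | n) hn
    · rfl
    · exact congrArg (PRel.rename some) (h n hn)

theorem fresh_den (M : LTerm PInv) {w : V} {ρ : ℕ → PRel V}
    (h : ∀ n, occ n M ≠ 0 → Fresh w (ρ n)) : Fresh w (den M ρ) := by
  induction M generalizing V with
  | var n => exact h n (by simp [occ])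
  | const a => exact fresh_const _ _
  | app M N ihM ihN =>
    exact (ihM fun n hn => h n (by simp [occ, hn])).app (ihN fun n hn => h n (by simp [occ, hn]))
  | lam M ih =>
    refine (ih ?_).curry
    rintro (_ | n) hn
    · exact fresh_wire nofun
    · exact (h n hn).rename (Option.some_injective V)

/-- Plugging into the port of a variable that occurs once. -/
theorem cut_den (M : LTerm PInv) {k : ℕ} (hk : occ k M = 1) {w : V} {ρ : ℕ → PRel V}
    (hρ : ρ k = wire w) (hρ' : ∀ n, n ≠ k → Fresh w (ρ n)) {G : PRel V} (hG : Fresh w G) :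
    cut w (den M ρ) G = den M (Function.update ρ k G) := by
  induction M generalizing V k with
  | var n =>
    obtain rfl : n = k := by simpa [occ] using hk
    simp only [den, hρ, cut_wire hG, Function.update_self]
  | const a => simp [occ] at hk
  | app M N ihM ihN =>
    simp only [occ] at hk
    have hcongr (N : LTerm PInv) (hN : occ k N = 0) : den N (Function.update ρ k G) = den N ρ :=
      den_congr N fun n hn => Function.update_of_ne (by rintro rfl; exact hn hN) _ _
    have hfresh (N : LTerm PInv) (hN : occ k N = 0) : Fresh w (den N ρ) :=
      fresh_den N fun n hn => hρ' n (by rintro rfl; exact hn hN)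
    simp only [den]
    -- The single occurrence lies in exactly one of the two subterms; the other one does not use
    -- port `w` and ignores the update.
    rcases Nat.eq_zero_or_pos (occ k M) with h | h
    · rw [cut_app_right (hfresh M h), ihN (by omega) hρ hρ' hG, hcongr M h]
    · have h' : occ k N = 0 := by omega
      rw [cut_app_left _ (hfresh N h'), ihM (by omega) hρ hρ' hG, hcongr N h']
  | lam M ih =>
    simp only [den]
    rw [cut_curry, ih (k := k + 1) hk]
    · congr 2
      ext1 n
      cases n with
      | zero => rfl
      | succ n => by_cases h : n = k <;> simp [Function.update, upEnv, h]
    · simp only [upEnv, hρ, rename_wire]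
    · rintro (_ | n) hn
      · exact fresh_wire nofun
      · exact (hρ' n (by simpa using hn)).rename (Option.some_injective V)
    · exact hG.rename (Option.some_injective V)

/-- Substitution evaluates the body with index `0` sent to the denotation of `N`; by `cut_den` this
is the same as plugging that denotation into the bound port. One occurrence is essential: with none,
the cut would keep the port-to-port paths of `N`. -/
theorem den_beta (M N : LTerm PInv) (h : occ 0 M = 1) (ρ : ℕ → PRel V) :
    den (app (lam M) N) ρ = den (inst M N) ρ := by
  apply rename_injective (Option.some_injective V)
  simp only [den, inst, den_subst]
  rw [rename_some_app_curry, cut_den (ρ := upEnv ρ) M h rfl, rename_den M (Option.some_injective V)]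
  · congr 1
    ext1 n
    cases n <;> rfl
  · rintro (_ | n) hn
    · contradiction
    · exact fresh_rename _ nofun
  · exact fresh_rename _ nofun

theorem Eqv.den_eq {M N : LTerm PInv} (h : Eqv .linear M N) (ρ : ℕ → PRel V) :
    den M ρ = den N ρ := by
  induction h generalizing V with
  | beta hM _ => exact den_beta _ _ hM.2 ρ
  | xi _ _ _ ih => exact congrArg PRel.curry (ih _)
  | app _ _ ihM ihN => simp only [den, ihM, ihN]
  | refl _ => rfl
  | symm _ ih => exact (ih ρ).symm
  | trans _ _ ih1 ih2 => exact (ih1 ρ).trans (ih2 ρ)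

end LTerm

/-! ### The linear λ-algebra of partial involutions -/

open LTerm PRel Pt Move

theorem PRel.curry_apply {V : Type} {F : PRel (Option V)} {p q : Pt (Option V)} (h : F p q) :
    PRel.curry F p.curry q.curry :=
  ⟨p, q, h, rfl, rfl⟩

/-- The bodies are built from wires, so `app_wire_left` and `app_wire_right` compute them. For `B`
and `C` the three abstractions place the variables `x`, `y`, `z` at `l`, `rl`, `r²l` and the result
at `r³`, which yields the listed pairs. -/
theorem den_toLam_comb {V : Type} (k : Comb .linear) (ρ : ℕ → PRel V) :
    den k.toLam ρ = PRel.const (PInv.comb k).rel := by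
  ext p q
  cases k with
  | B =>
    simp only [Comb.toLam, den, upEnv, rename_wire]
    constructor
    · simp only [PRel.curry, Relation.Map, app_wire_left, app_wire_right]
      rintro ⟨_, _, ⟨_, _, ⟨_, _, ⟨_, ⟨rfl, rfl⟩ | ⟨rfl, rfl⟩⟩
        | ⟨_, _, ⟨_, _, h, hp, hq⟩, hp', hq'⟩,
        rfl, rfl⟩, rfl, rfl⟩, rfl, rfl⟩
      · exact .mk (.inl ⟨_, .inl ⟨rfl, rfl⟩⟩)
      · exact .mk (.inr ⟨_, .inl ⟨rfl, rfl⟩⟩)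
      · cases h <;> cases hp <;> cases hq <;> cases hp' <;> cases hq'
        · exact .mk (.inl ⟨_, .inr (.inl ⟨rfl, rfl⟩)⟩)
        · exact .mk (.inr ⟨_, .inr (.inr ⟨rfl, rfl⟩)⟩)
        · exact .mk (.inr ⟨_, .inr (.inl ⟨rfl, rfl⟩)⟩)
        · exact .mk (.inl ⟨_, .inr (.inr ⟨rfl, rfl⟩)⟩)
    · rintro ⟨⟨x, ⟨rfl, rfl⟩ | ⟨rfl, rfl⟩ | ⟨rfl, rfl⟩⟩ | ⟨x, ⟨rfl, rfl⟩ | ⟨rfl, rfl⟩ | ⟨rfl, rfl⟩⟩⟩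
      · refine curry_apply (curry_apply (curry_apply (p := out x)
          (q := port (some (some none)) (r x)) ?_))
        exact (app_wire_left _ _ _ _).2 (.inl ⟨x, .inl ⟨rfl, rfl⟩⟩)
      · refine curry_apply (curry_apply (curry_apply (p := port (some (some none)) (l x))
          (q := port (some none) (r x)) ?_))
        exact (app_wire_left _ _ _ _).2
          (.inr ⟨_, _, (app_wire_right _ _ _ _).2
            ⟨_, _, .inward _, .out _, .port _ _⟩, .out _, .port _ _⟩)
      · refine curry_apply (curry_apply (curry_apply (p := port (some none) (l x))
          (q := port none x) ?_))
        exact (app_wire_left _ _ _ _).2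
          (.inr ⟨_, _, (app_wire_right _ _ _ _).2
            ⟨_, _, .outward _, .port _ _, .arg _⟩, .port _ _, .port _ _⟩)
      · refine curry_apply (curry_apply (curry_apply (p := port (some (some none)) (r x))
          (q := out x) ?_))
        exact (app_wire_left _ _ _ _).2 (.inl ⟨x, .inr ⟨rfl, rfl⟩⟩)
      · refine curry_apply (curry_apply (curry_apply (p := port (some none) (r x))
          (q := port (some (some none)) (l x)) ?_))
        exact (app_wire_left _ _ _ _).2
          (.inr ⟨_, _, (app_wire_right _ _ _ _).2
            ⟨_, _, .outward _, .port _ _, .out _⟩, .port _ _, .out _⟩)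
      · refine curry_apply (curry_apply (curry_apply (p := port none x)
          (q := port (some none) (l x)) ?_))
        exact (app_wire_left _ _ _ _).2
          (.inr ⟨_, _, (app_wire_right _ _ _ _).2
            ⟨_, _, .inward _, .arg _, .port _ _⟩, .port _ _, .port _ _⟩)
  | C =>
    simp only [Comb.toLam, den, upEnv, rename_wire]
    constructor
    · simp only [PRel.curry, Relation.Map, app_wire_right]
      rintro ⟨_, _, ⟨_, _, ⟨_, _, ⟨_, _, ⟨_, _, h, hp, hq⟩, hp', hq'⟩,
        rfl, rfl⟩, rfl, rfl⟩, rfl, rfl⟩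
      cases h <;> cases hp <;> cases hq <;> cases hp' <;> cases hq'
      · exact .mk (.inr ⟨_, .inr (.inr ⟨rfl, rfl⟩)⟩)
      · exact .mk (.inr ⟨_, .inr (.inl ⟨rfl, rfl⟩)⟩)
      · exact .mk (.inr ⟨_, .inl ⟨rfl, rfl⟩⟩)
      · exact .mk (.inl ⟨_, .inr (.inr ⟨rfl, rfl⟩)⟩)
      · exact .mk (.inl ⟨_, .inr (.inl ⟨rfl, rfl⟩)⟩)
      · exact .mk (.inl ⟨_, .inl ⟨rfl, rfl⟩⟩)
    · rintro ⟨⟨x, ⟨rfl, rfl⟩ | ⟨rfl, rfl⟩ | ⟨rfl, rfl⟩⟩ | ⟨x, ⟨rfl, rfl⟩ | ⟨rfl, rfl⟩ | ⟨rfl, rfl⟩⟩⟩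
      · refine curry_apply (curry_apply (curry_apply (p := port (some (some none)) (l x))
          (q := port none x) ?_))
        exact (app_wire_right _ _ _ _).2
          ⟨_, _, (app_wire_right _ _ _ _).2
            ⟨_, _, .outward _, .port _ _, .arg _⟩, .port _ _, .port _ _⟩
      · refine curry_apply (curry_apply (curry_apply (p := port (some (some none)) (r (l x)))
          (q := port (some none) x) ?_))
        exact (app_wire_right _ _ _ _).2
          ⟨_, _, (app_wire_right _ _ _ _).2
            ⟨_, _, .outward _, .port _ _, .out _⟩, .port _ _, .arg _⟩
      · refine curry_apply (curry_apply (curry_apply (p := port (some (some none)) (r (r x)))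
          (q := out x) ?_))
        exact (app_wire_right _ _ _ _).2
          ⟨_, _, (app_wire_right _ _ _ _).2
            ⟨_, _, .outward _, .port _ _, .out _⟩, .port _ _, .out _⟩
      · refine curry_apply (curry_apply (curry_apply (p := port none x)
          (q := port (some (some none)) (l x)) ?_))
        exact (app_wire_right _ _ _ _).2
          ⟨_, _, (app_wire_right _ _ _ _).2
            ⟨_, _, .inward _, .arg _, .port _ _⟩, .port _ _, .port _ _⟩
      · refine curry_apply (curry_apply (curry_apply (p := port (some none) x)
          (q := port (some (some none)) (r (l x))) ?_))
        exact (app_wire_right _ _ _ _).2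
          ⟨_, _, (app_wire_right _ _ _ _).2 ⟨_, _, .inward _, .out _, .port _ _⟩, .arg _, .port _ _⟩
      · refine curry_apply (curry_apply (curry_apply (p := out x)
          (q := port (some (some none)) (r (r x))) ?_))
        exact (app_wire_right _ _ _ _).2
          ⟨_, _, (app_wire_right _ _ _ _).2 ⟨_, _, .inward _, .out _, .port _ _⟩, .out _, .port _ _⟩
  | I =>
    simp only [Comb.toLam, den, upEnv, PRel.curry, Relation.Map]
    constructor
    · rintro ⟨_, _, h | h, rfl, rfl⟩
      · exact .mk (.inr ⟨_, rfl, rfl⟩)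
      · exact .mk (.inl ⟨_, rfl, rfl⟩)
    · rintro ⟨⟨x, rfl, rfl⟩ | ⟨x, rfl, rfl⟩⟩
      · exact ⟨_, _, .outward x, rfl, rfl⟩
      · exact ⟨_, _, .inward x, rfl, rfl⟩

theorem den_toLam {V : Type} (M : CLTerm .linear PInv) (ρ : ℕ → PInv) :
    den M.toLam (fun n => (PRel.const (ρ n).rel : PRel V)) =
      PRel.const ((PInv.structureP .linear).interp ρ M).rel := by
  induction M with
  | var n => rfl
  | comb k => exact den_toLam_comb k _
  | const a => rfl
  | app M N ihM ihN =>
    simp only [CLTerm.toLam, den, ihM, ihN, app_const]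
    rfl

theorem interp_eq_of_eqv {M N : CLTerm .linear PInv} (h : Eqv .linear M.toLam N.toLam)
    (ρ : ℕ → PInv) :
    (PInv.structureP .linear).interp ρ M = (PInv.structureP .linear).interp ρ N := by
  apply PRel.const_injective (V := Empty)
  rw [← den_toLam, ← den_toLam, h.den_eq]

end StrictLambda

namespace StrictLambda

namespace PInv

open LTerm Move

/-! ### Combinatory algebras -/

/-- Each law is a provable equality between terms with constants, hence holds by soundness; the
valuation plays no role. -/
theorem satisfiesBCI_linear : (structureP .linear).SatisfiesBCI where
  B_law x y z := by
    refine interp_eq_of_eqv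
      (M := .app (.app (.app (.comb .B) (.const x)) (.const y)) (.const z))
      (N := .app (.const x) (.app (.const y) (.const z))) ?_ fun _ => x
    have h₁ : Eqv .linear (.app (Comb.B (X := .linear)).toLam (.const x))
        (.lam (.lam (.app (.const x) (.app (.var 1) (.var 0))))) :=
      .beta (by simp [WF, Abstractable, occ]) trivial
    have h₂ : Eqv .linear (.app (.lam (.lam (.app (.const x) (.app (.var 1) (.var 0))))) (.const y))
        (.lam (.app (.const x) (.app (.const y) (.var 0)))) :=
      .beta (by simp [WF, Abstractable, occ]) trivial
    have h₃ : Eqv .linear (.app (.lam (.app (.const x) (.app (.const y) (.var 0)))) (.const z))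
        (.app (.const x) (.app (.const y) (.const z))) :=
      .beta (by simp [WF, Abstractable, occ]) trivial
    have hy : Eqv .linear (.const y) (.const y) := .refl trivial
    exact .trans (.app (.trans (.app h₁ hy) h₂) (.refl trivial)) h₃
  C_law x y z := by
    refine interp_eq_of_eqv
      (M := .app (.app (.app (.comb .C) (.const x)) (.const y)) (.const z))
      (N := .app (.app (.const x) (.const z)) (.const y)) ?_ fun _ => x
    have h₁ : Eqv .linear (.app (Comb.C (X := .linear)).toLam (.const x))
        (.lam (.lam (.app (.app (.const x) (.var 0)) (.var 1)))) :=
      .beta (by simp [WF, Abstractable, occ]) trivial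
    have h₂ : Eqv .linear (.app (.lam (.lam (.app (.app (.const x) (.var 0)) (.var 1)))) (.const y))
        (.lam (.app (.app (.const x) (.var 0)) (.const y))) :=
      .beta (by simp [WF, Abstractable, occ]) trivial
    have h₃ : Eqv .linear (.app (.lam (.app (.app (.const x) (.var 0)) (.const y))) (.const z))
        (.app (.app (.const x) (.const z)) (.const y)) :=
      .beta (by simp [WF, Abstractable, occ]) trivial
    have hy : Eqv .linear (.const y) (.const y) := .refl trivial
    exact .trans (.app (.trans (.app h₁ hy) h₂) (.refl trivial)) h₃
  I_law x := by
    refine interp_eq_of_eqv (M := .app (.comb .I) (.const x)) (N := .const x) ?_ fun _ => x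
    exact .beta (by simp [WF, Abstractable, occ]) trivial

theorem satisfiesBCI_affine : (structureP .affine).SatisfiesBCI where
  B_law := satisfiesBCI_linear.B_law
  C_law := satisfiesBCI_linear.C_law
  I_law := satisfiesBCI_linear.I_law

theorem comb_K_rel {u v : Move} : (comb .K).rel u v ↔
    ∃ x, u = l x ∧ v = r (r x) ∨ u = r (r x) ∧ v = l x := by
  simp only [comb, pairs, ← exists_or]
  refine exists_congr fun x => ?_
  tauto

/-- `K` has no pair from `l` to `l`, so the path crosses `f` exactly once and `f` reappears under
`r`. Nothing is left under `l`, so a second argument is never entered. -/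
theorem K_app_rel {f : PInv} {u v : Move} :
    (app (comb .K) f).rel u v ↔ ∃ x y, u = r x ∧ v = r y ∧ f.rel x y := by
  constructor
  · rintro (h | ⟨d, ⟨b, ⟨a, h1, h2⟩, h3⟩, h4⟩)
    · simp [part, comb_K_rel] at h
    · simp only [part, comb_K_rel] at h1 h4
      rcases Relation.ReflTransGen.cases_head h3 with rfl | ⟨_, ⟨_, h, _⟩, _⟩
      · obtain ⟨x, ⟨h1, -⟩ | ⟨h1, h1'⟩⟩ := h1
        · cases h1
        · cases h1
          cases h1'
          obtain ⟨y, ⟨h4, h4'⟩ | ⟨h4, -⟩⟩ := h4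
          · cases h4
            cases h4'
            exact ⟨_, _, rfl, rfl, h2⟩
          · cases h4
      · simp [part, comb_K_rel] at h
  · rintro ⟨x, y, rfl, rfl, h⟩
    exact .inr ⟨y, ⟨y, ⟨x, comb_K_rel.2 ⟨x, .inr ⟨rfl, rfl⟩⟩, h⟩, .refl⟩,
      comb_K_rel.2 ⟨y, .inl ⟨rfl, rfl⟩⟩⟩

theorem K_law (f g : PInv) : app (app (comb .K) f) g = f := by
  ext u v
  constructor
  · rintro (h | ⟨d, ⟨b, ⟨a, h1, _⟩, _⟩, _⟩)
    · obtain ⟨x, y, h1, h2, h⟩ := K_app_rel.1 h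
      cases h1
      cases h2
      exact h
    · obtain ⟨_, _, _, h, _⟩ := K_app_rel.1 h1
      cases h
  · intro h
    exact .inl (K_app_rel.2 ⟨_, _, rfl, rfl, h⟩)

/-! ### Selectors -/

/-- The partial involution with the single pair `a ↔ b`. -/
def single (a b : Move) : PInv where
  rel u v := u = a ∧ v = b ∨ u = b ∧ v = a
  symm := by tauto
  functional := by grind

/-- The empty partial involution. -/
def empty : PInv where
  rel _ _ := False
  symm := id
  functional := nofun

/-- The values of `ε` at a few moves are forced by the law `εxy = xy` for one-pair `x`;
extensionality then fails between an involution with only an `l`-to-`l` pair and the empty one. -/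
theorem not_isSelector (ε : PInv) : ¬ (structureP .linear).IsSelector ε := by
  rintro ⟨happ, hext⟩
  -- With this `x`, the pair `e ↔ e` is in `xz` for `z` the loop at `a`, but not for `z` empty. So
  -- `εx` must consult `z` when entered at `r e`, and can do so only at `a`.
  have hx (a : Move) : (app ε (single (r e) (l a))).rel (r e) (l a) := by
    have hxz : (app (single (r e) (l a)) (single a a)).rel e e :=
      .inr ⟨a, ⟨a, ⟨a, .inl ⟨rfl, rfl⟩, .inl ⟨rfl, rfl⟩⟩, .refl⟩, .inr ⟨rfl, rfl⟩⟩
    have hne : ¬ (app (single (r e) (l a)) empty).rel e e := by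
      rintro (h | ⟨_, ⟨_, ⟨_, _, h⟩, _⟩, _⟩)
      · simp [part, single] at h
      · exact h
    have h₁ := happ (single (r e) (l a)) (single a a)
    have h₂ := happ (single (r e) (l a)) empty
    change app (app ε _) _ = app _ _ at h₁ h₂
    rw [← h₁] at hxz
    rw [← h₂] at hne
    rcases hxz with h | ⟨_, ⟨_, ⟨b, h, hb⟩, _⟩, _⟩
    · exact (hne (.inl h)).elim
    · obtain rfl : b = a := hb.elim And.left And.left
      exact h
  have hhead (a : Move) : ε.rel (r (r e)) (r (l a)) ∨
      ∃ p, (p = r e ∨ p = l a) ∧ ε.rel (r (r e)) (l p) := by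
    rcases hx a with h | ⟨_, ⟨_, ⟨p, h, hp⟩, _⟩, _⟩
    · exact .inl h
    · exact .inr ⟨p, hp.imp And.left And.left, h⟩
  -- The value of `ε` at `r (r e)` cannot depend on `a`; comparing `a = e` with `a = l e` leaves
  -- only `p = r e`.
  have hout : ε.rel (r (r e)) (l (r e)) := by
    rcases hhead e with h | ⟨p, rfl | rfl, h⟩
    · rcases hhead (l e) with h' | ⟨p, -, h'⟩ <;> cases ε.functional h h'
    · exact h
    · rcases hhead (l e) with h' | ⟨p, rfl | rfl, h'⟩ <;> cases ε.functional h h'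
  -- Follow the path for `a = e` after it has crossed the pair: a detour through `ε` would revisit
  -- `l (r e)`, which `ε` sends back to `r (r e)`, not to the required exit.
  have harg : ε.rel (l (l e)) (r (l e)) := by
    rcases hx e with h | ⟨d, ⟨b, ⟨p, h, hp⟩, hloop⟩, hd⟩
    · cases ε.functional hout h
    · cases ε.functional hout h
      rcases hp with ⟨-, rfl⟩ | ⟨hp, -⟩
      swap
      · cases hp
      rcases Relation.ReflTransGen.cases_head hloop with rfl | ⟨c, ⟨y, hy, hyc⟩, hloop⟩
      · exact hd
      rcases hyc with ⟨rfl, rfl⟩ | ⟨rfl, rfl⟩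
      · cases ε.functional (ε.symm hout) (ε.symm hy)
      rcases Relation.ReflTransGen.cases_head hloop with rfl | ⟨c, ⟨y', hy', _⟩, _⟩
      · cases ε.functional (ε.symm hout) hd
      · cases ε.functional (ε.symm hout) hy'
  -- Without a pair that touches `r`, neither involution yields anything when applied.
  have heq : app ε (single (l e) (l e)) = app ε empty := by
    refine hext _ _ fun z => ?_
    ext u v
    constructor
    · rintro (h | ⟨_, ⟨_, ⟨_, h, _⟩, _⟩, _⟩) <;> simp [part, single] at h
    · rintro (h | ⟨_, ⟨_, ⟨_, h, _⟩, _⟩, _⟩) <;> exact h.elim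
  have h : (app ε (single (l e) (l e))).rel (l e) (l e) :=
    .inr ⟨_, ⟨_, ⟨_, ε.symm harg, .inl ⟨rfl, rfl⟩⟩, .refl⟩, harg⟩
  rw [heq] at h
  rcases h with h | ⟨_, ⟨_, ⟨_, _, h⟩, _⟩, _⟩
  · cases ε.functional (ε.symm harg) h
  · exact h

/-! ### The terms `BBK` and `BKK` -/

/-- The witness joins the argument side of `y` to `z`: it is the trace of the erased term `y z` in
`λxyz.(λw.x)(yz)`. In `BKK` the corresponding path reaches `K` at a move of the form `r (l _)`,
where `K` is undefined. -/
theorem BBK_ne_BKK : app (app (comb (X := .affine) .B) (comb (X := .affine) .B)) (comb .K) ≠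
    app (app (comb (X := .affine) .B) (comb .K)) (comb .K) := by
  intro heq
  have h : (app (app (comb (X := .affine) .B) (comb (X := .affine) .B)) (comb .K)).rel (r (l (l e)))
      (r (r (l e))) :=
    .inl (.inr ⟨_, ⟨_, ⟨_, .inl ⟨l (l e), .inl ⟨rfl, rfl⟩⟩,
      .inl ⟨e, .inr (.inr ⟨rfl, rfl⟩)⟩⟩, .refl⟩, .inr ⟨r (l e), .inl ⟨rfl, rfl⟩⟩⟩)
  have hB : (comb (X := .affine) .B).rel (r (r (r (l (l e))))) (l (r (l (l e)))) :=
    .inl ⟨_, .inl ⟨rfl, rfl⟩⟩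
  have hne (v) : ¬ (app (comb (X := .affine) .B) (comb .K)).rel (r (r (l (l e)))) v := by
    rintro (h | ⟨_, ⟨_, ⟨_, h, h'⟩, _⟩, _⟩)
    · cases (comb .B).functional hB h
    · cases (comb .B).functional hB h
      simp [comb_K_rel] at h'
  rw [heq] at h
  rcases h with h | ⟨_, ⟨_, ⟨_, h, _⟩, _⟩, _⟩ <;> exact hne _ h

end PInv

/-! ### Provable equality of `BBK` and `BKK` -/

namespace LTerm

/-- For `T` equal to `B` or `K`, the term `B T K` reduces to `λx.T(λw.x)`, and in both cases
`T(λw.x)` reduces to `λyz.x`. -/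
theorem eqv_BBK_BKK (A : Type*) : Eqv .affine (BBK A).toLam (BKK A).toLam := by
  set B : LTerm A := (Comb.B (X := .affine)).toLam with hB
  set K : LTerm A := Comb.K.toLam with hK
  have wB : WF .affine B := by simp [hB, Comb.toLam, WF, Abstractable, occ]
  have wK : WF .affine K := by simp [hK, Comb.toLam, WF, Abstractable, occ]
  -- The invariance hypotheses express that `T` is closed, so that it passes unchanged through
  -- substitutions and binders.
  have comp {T : LTerm A} (hT : WF .affine T)
      (h : ∀ σ, subst σ T = T) (h' : ∀ f, rename f T = T) (h'' : ∀ n, occ n T = 0) :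
      Eqv .affine (.app (.app B T) K) (.lam (.app T (.lam (.var 1)))) := by
    have h₁ : Eqv .affine (.app B T) (.lam (.lam (.app T (.app (.var 1) (.var 0))))) := by
      have := Eqv.beta (X := .affine) (M := .lam (.lam (.app (.var 2) (.app (.var 1) (.var 0)))))
        (N := T) (by simp [WF, Abstractable, occ]) hT
      simp only [inst, subst, up, rename, h'] at this
      exact this
    have h₂ : Eqv .affine (.app (.lam (.lam (.app T (.app (.var 1) (.var 0))))) K)
        (.lam (.app T (.app K (.var 0)))) := by
      have := Eqv.beta (X := .affine) (M := .lam (.app T (.app (.var 1) (.var 0))))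
        (N := K) (by simp [WF, Abstractable, occ, h'', hT]) wK
      simp only [inst, subst, up, h] at this
      exact this
    have h₃ : Eqv .affine (.app K (.var 0)) (.lam (.var 1) : LTerm A) :=
      .beta (by simp [WF, Abstractable, occ]) trivial
    refine .trans (.trans (.app h₁ (.refl wK)) h₂) (.xi (.app (.refl hT) h₃) ?_ ?_)
    · simp [Abstractable, occ, h'', hK, Comb.toLam]
    · simp [Abstractable, occ, h'']
  have hKT : Eqv .affine (.app K (.lam (.var 1))) (.lam (.lam (.var 2)) : LTerm A) :=
    .beta (by simp [WF, Abstractable, occ]) (by simp [WF, Abstractable, occ])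
  have hBT : Eqv .affine (.app B (.lam (.var 1))) (.lam (.lam (.var 2)) : LTerm A) := by
    have h₁ : Eqv .affine (.app B (.lam (.var 1)))
        (.lam (.lam (.app (.lam (.var 3)) (.app (.var 1) (.var 0)))) : LTerm A) :=
      .beta (by simp [WF, Abstractable, occ]) (by simp [WF, Abstractable, occ])
    -- This β step, under two binders, erases the open argument `y z`; it is the one that the affine
    -- structure does not respect.
    refine .trans h₁ (.xi (.xi (.beta ?_ ?_) ?_ ?_) ?_ ?_) <;>
      simp [WF, Abstractable, occ]
  refine .trans (comp wB ?_ ?_ ?_) (.trans (.xi (.trans hBT hKT.symm) ?_ ?_)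
    (comp wK ?_ ?_ ?_).symm)
  all_goals intros
  all_goals first | rfl | simp [Abstractable, occ, hK, CLTerm.toLam, Comb.toLam]

end LTerm

end StrictLambda

theorem mainTheorem2 :
    ((StrictLambda.PInv.structureP .linear).IsCombAlgebra ∧
      (StrictLambda.PInv.structureP .linear).IsLambdaAlgebra ∧
      (¬ ∃ ε : StrictLambda.PInv, (StrictLambda.PInv.structureP .linear).IsSelector ε) ∧
      ¬ (StrictLambda.PInv.structureP .linear).IsCombinatoryModel) ∧
    ((StrictLambda.PInv.structureP .affine).IsCombAlgebra ∧
      ¬ (StrictLambda.PInv.structureP .affine).IsLambdaAlgebra ∧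
      StrictLambda.LTerm.Eqv .affine (StrictLambda.BBK StrictLambda.PInv).toLam
        (StrictLambda.BKK StrictLambda.PInv).toLam ∧
      ∀ ρ : ℕ → StrictLambda.PInv,
        (StrictLambda.PInv.structureP .affine).interp ρ (StrictLambda.BBK StrictLambda.PInv) ≠
          (StrictLambda.PInv.structureP .affine).interp ρ
            (StrictLambda.BKK StrictLambda.PInv)) := by
  have hsel : ¬ ∃ ε : StrictLambda.PInv, (StrictLambda.PInv.structureP .linear).IsSelector ε :=
    fun ⟨ε, hε⟩ => StrictLambda.PInv.not_isSelector ε hε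
  have heqv := StrictLambda.LTerm.eqv_BBK_BKK StrictLambda.PInv
  refine ⟨⟨StrictLambda.PInv.satisfiesBCI_linear, ⟨StrictLambda.PInv.satisfiesBCI_linear,
    fun M N _ _ h ρ => StrictLambda.interp_eq_of_eqv h ρ⟩, hsel, fun h => hsel h.2⟩,
    ⟨StrictLambda.PInv.satisfiesBCI_affine, StrictLambda.PInv.K_law⟩, fun h => ?_, heqv,
    fun _ => StrictLambda.PInv.BBK_ne_BKK⟩
  exact StrictLambda.PInv.BBK_ne_BKK (h.2 (StrictLambda.BBK _) (StrictLambda.BKK _)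
    ⟨⟨trivial, trivial⟩, trivial⟩ ⟨⟨trivial, trivial⟩, trivial⟩ heqv
    fun _ => StrictLambda.PInv.empty)
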